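/- Proposition (type $B/C$ Catalan numbers). Let $\Delta^+_{A_m}=\{(i,j): 1\le i<j\le m+1\}$, where $(i,j)$ stands for the positive root $e_i-e_j$, and for $\sigma\in S_{m+1}$ let $\mathrm{Inv}(\sigma)=\{(i,j)\in\Delta^+_{A_m}:\sigma(i)>\sigma(j)\}$. Let $$\Delta^+_{B_n}=\{\varepsilon_i\pm\varepsilon_j: 1\le i<j\le n\}\cup\{\varepsilon_i:1\le i\le n\},\qquad \Delta^+_{C_n}=\{\varepsilon_i\pm\varepsilon_j: 1\le i<j\le n\}\cup\{2\varepsilon_i:1\le i\le n\},$$ with simple roots $\varepsilon_i-\varepsilon_{i+1}$ $(1\le i\le n-1)$ together with $\varepsilon_n$ (type $B$), respectively $2\varepsilon_n$ (type $C$). The Weyl group $\mathcal W$ of both types is the group of signed permutations of $\{\pm\varepsilon_1,\dots,\pm\varepsilon_n\}$, and for $\sigma\in\mathcal W$ the inversion set is $\mathrm{Inv}(\sigma)=\{v\in\Delta^+: -\sigma v\in\Delta^+\}$. A decomposition of $\Delta^+$ is a set of pairwise disjoint inversion sets whose union is $\Delta^+$. For $m\ge 0$ let $\mathrm{Cat}_m$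 be the number of decompositions of $\Delta^+_{A_m}$ into exactly $m$ non-empty inversion sets. For $n\ge 0$ let $\mathrm{Cat}^B_n$ (resp. $\mathrm{Cat}^C_n$) be the number of decompositions of $\Delta^+_{B_n}$ (resp. $\Delta^+_{C_n}$) into inversion sets each of which contains exactly one simple root. Then 1. $\mathrm{Cat}_m=\frac1{m+1}\binom{2m}{m}$, the $m$-th Catalan number, for all $m\ge0$; 2. $\mathrm{Cat}^C_n=\mathrm{Cat}^B_n$ for all $n\ge 0$; 3. for all $n\ge1$, $$\mathrm{Cat}^B_n=\mathrm{Cat}^B_{n-1}+2\sum_{k=0}^{n-2}\mathrm{Cat}_{n-k-1}\,\mathrm{Cat}^B_k;$$ 4. as formal power series over $\mathbb Q$, $$\sum_{n\ge0}\mathrm{Cat}^B_n z^n=\frac{1}{(1-4z)^{1/2}+z},$$ where $(1-4z)^{1/2}=\sum_{k\ge0}\binom{1/2}{k}(-4z)^k$. In particular $\mathrm{Cat}^B_0=1$. -/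

import Mathlib

open scoped Pointwise

namespace InvSets

/-- `D` is a decomposition of `S`: a set of pairwise disjoint inversion sets with union `S`,
where `inv` is the collection of all inversion sets. -/
structure IsDecomposition {R : Type*} (inv : Set (Set R)) (S : Set R) (D : Set (Set R)) :
    Prop where
  subset_inv : D ⊆ inv
  disjoint : D.PairwiseDisjoint id
  sUnion_eq : ⋃₀ D = S

section TypeA

/-- Positive roots of type `A_{n-1}`: the pair `(i, j)` with `i < j` stands for `e_i - e_j`. -/
def posRootsA (n : ℕ) : Set (Fin n × Fin n) := {p | p.1 < p.2}

/-- The inversion set of a permutation. -/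
def invA {n : ℕ} (σ : Equiv.Perm (Fin n)) : Set (Fin n × Fin n) :=
  {p | p ∈ posRootsA n ∧ σ p.2 < σ p.1}

/-- The number of decompositions of the positive roots of type `A_m` (Weyl group `S_{m+1}`)
into exactly `m` non-empty inversion sets. -/
noncomputable def catA (m : ℕ) : ℕ :=
  Set.ncard {D : Set (Set (Fin (m + 1) × Fin (m + 1))) |
    IsDecomposition (Set.range (invA (n := m + 1))) (posRootsA (m + 1)) D ∧
      (∀ Φ ∈ D, Φ.Nonempty) ∧ D.ncard = m}

end TypeA

section TypeBC

/-- The lattice `ℤ^n` in `ℝ^n`; it contains all the roots of types `B_n` and `C_n`. -/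
abbrev V (n : ℕ) : Type := Fin n → ℤ

/-- The standard basis vector `ε_i`. -/
def ε {n : ℕ} (i : Fin n) : V n := Pi.single i 1

/-- `Δ⁺` for `B_n`: `ε_i - ε_j` and `ε_i + ε_j` for `i < j`, and `ε_i`. -/
def posRootsB (n : ℕ) : Set (V n) :=
  {v | (∃ i j : Fin n, i < j ∧ (v = ε i - ε j ∨ v = ε i + ε j)) ∨ ∃ i : Fin n, v = ε i}

/-- Simple roots of `B_n`: `ε_i - ε_{i+1}`, and `ε_n`. -/
def simpleRootsB (n : ℕ) : Set (V n) :=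
  {v | (∃ i j : Fin n, (i : ℕ) + 1 = j ∧ v = ε i - ε j) ∨ ∃ i : Fin n, (i : ℕ) + 1 = n ∧ v = ε i}

/-- `Δ⁺` for `C_n`: `ε_i - ε_j` for `i < j`, and `ε_i + ε_j` for `i ≤ j`. -/
def posRootsC (n : ℕ) : Set (V n) :=
  {v | (∃ i j : Fin n, i < j ∧ v = ε i - ε j) ∨ ∃ i j : Fin n, i ≤ j ∧ v = ε i + ε j}

/-- Simple roots of `C_n`: `ε_i - ε_{i+1}`, and `2 ε_n`. -/
def simpleRootsC (n : ℕ) : Set (V n) :=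
  {v | (∃ i j : Fin n, (i : ℕ) + 1 = j ∧ v = ε i - ε j) ∨
    ∃ i : Fin n, (i : ℕ) + 1 = n ∧ v = 2 • ε i}

/-- The set `{± ε_i}`. -/
def signedBasis (n : ℕ) : Set (V n) := {v | ∃ i : Fin n, v = ε i ∨ v = -ε i}

/-- The common Weyl group of `B_n` and `C_n`: the group of signed permutations, i.e. the linear
automorphisms that map the set `{± ε_i}` onto itself. -/
def weylGroup (n : ℕ) : Subgroup (V n ≃ₗ[ℤ] V n) :=
  MulAction.stabilizer (V n ≃ₗ[ℤ] V n) (signedBasis n)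

/-- The inversion set of `σ` with respect to positive roots `P`: those `v ∈ P` that `σ` maps to
a negative root. -/
def inv {n : ℕ} (P : Set (V n)) (σ : weylGroup n) : Set (V n) :=
  {v | v ∈ P ∧ -(σ.1 v) ∈ P}

/-- The number of decompositions of the positive roots `P` into inversion sets each of which
contains exactly one element of the set `S` of simple roots. -/
noncomputable def catBC (n : ℕ) (P S : Set (V n)) : ℕ :=
  Set.ncard {D : Set (Set (V n)) |
    IsDecomposition (Set.range (inv P)) P D ∧ ∀ Φ ∈ D, ∃! α, α ∈ Φ ∧ α ∈ S}

noncomputable def catB (n : ℕ) : ℕ := catBC n (posRootsB n) (simpleRootsB n)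

noncomputable def catC (n : ℕ) : ℕ := catBC n (posRootsC n) (simpleRootsC n)

end TypeBC

/-- The formal power series `(1 - 4z)^{1/2}`: Newton's binomial series of `(1 + z)^{1/2}` with
`-4z` substituted for `z`. -/
noncomputable def sqrtOneSubFour : PowerSeries ℚ :=
  PowerSeries.rescale (-4 : ℚ) (PowerSeries.binomialSeries ℚ (1 / 2 : ℚ))

end InvSets

namespace InvSets

/-! Label each block of a decomposition by its only simple root. The decomposition becomes a
colouring of the positive roots by simple roots in which each simple root has its own colour and
every colour class is an inversion set (`ncard_decompositions`). In type A, non-empty inversion sets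
contain simple roots, so having exactly `m` non-empty blocks means having one simple root per block
(`decompositionA_iff`).

A set of pairs is an inversion set when reversing these pairs in the natural order leaves a linear
order. For all colour classes together this says that, for `i < j < k`, the colour of `(i, k)` is
that of `(i, j)` or that of `(j, k)` (`exists_rank`, `triple_of_invA`). If `r` is the colour of the
longest pair, every pair crossing the cut between `r` and `r + 1` has colour `r`, and the two sides
are coloured independently. This is the Catalan recursion (`pairColorings_split`).

In types B and C the sign of the image of a root does not see whether the root is `ε i` or `2 ε i`,
so both types lead to the same `signedColorings`, which are the colourings of `[0, 2n)` symmetric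
under reversal. Let `R` be the colour attached to the index pair `(a, a)`. There is `S ≥ R` such
that only the differences inside `[a, S]` and the roots supported beyond `S` remain free
(`signedColorings_structure`). Either `R = S`, or `R < S` and `R` is the colour of the longest pair
in `[a, S]`. Each colouring of `[a, S]` thus counts twice, but only once when `S = a`. With `C` the
Catalan series and `B` the series sought, this gives `B = 1 + z (2 C B - B)`, and `1 - 2 z C` is the
square root of `1 - 4 z`. -/

/-- Counting a set by an explicit bijection with a disjoint union of finite sets. -/
theorem finite_and_ncard_eq_sum {α β ι : Type*} {X : Set α} (I : Finset ι) (Y : ι → Set β)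
    (f : ι → β → α) (g : α → ι × β) (hY : ∀ i ∈ I, (Y i).Finite)
    (hf : ∀ i ∈ I, ∀ y ∈ Y i, f i y ∈ X ∧ g (f i y) = (i, y))
    (hg : ∀ x ∈ X, (g x).1 ∈ I ∧ (g x).2 ∈ Y (g x).1 ∧ f (g x).1 (g x).2 = x) :
    X.Finite ∧ X.ncard = ∑ i ∈ I, (Y i).ncard := by
  classical
  have hX : X = ⋃ i ∈ I, f i '' Y i := by
    ext x
    simp only [Set.mem_iUnion, Set.mem_image, exists_prop]
    constructor
    · intro hx
      exact ⟨_, (hg x hx).1, _, (hg x hx).2.1, (hg x hx).2.2⟩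
    · rintro ⟨i, hi, y, hy, rfl⟩
      exact (hf i hi y hy).1
  have hfin : X.Finite := by
    rw [hX]
    exact I.finite_toSet.biUnion fun i hi => (hY i hi).image _
  refine ⟨hfin, ?_⟩
  rw [Set.ncard_eq_toFinset_card X hfin,
    Finset.card_eq_sum_card_fiberwise (f := fun x => (g x).1) (t := I)
      (fun x hx => (hg x (by simpa using hx)).1)]
  refine Finset.sum_congr rfl fun i hi => ?_
  rw [← Set.ncard_coe_finset]
  symm
  refine Set.ncard_congr (fun y _ => f i y) ?_ ?_ ?_
  · intro y hy
    simp [hf i hi y hy]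
  · intro y z hy hz h
    have h1 := (hf i hi y hy).2
    rw [h, (hf i hi z hz).2] at h1
    exact (congrArg Prod.snd h1).symm
  · intro x hx
    simp only [Finset.coe_filter, Set.Finite.mem_toFinset, Set.mem_ofPred_eq] at hx
    obtain ⟨hx, rfl⟩ := hx
    exact ⟨_, (hg x hx).2.1, (hg x hx).2.2⟩

/-! ### Type A colourings and the Catalan recursion -/

/-- Colourings of the pairs `a ≤ i < j < b` in which `(i, i + 1)` has colour `i` and the colour of
`(i, k)` is that of `(i, j)` or that of `(j, k)` whenever `i < j < k`. -/
def pairColorings (a b : ℕ) : Set (ℕ → ℕ → ℕ) :=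
  {d | (∀ i j, ¬(a ≤ i ∧ i < j ∧ j < b) → d i j = 0) ∧
    (∀ i, a ≤ i → i + 1 < b → d i (i + 1) = i) ∧
    ∀ i j k, a ≤ i → i < j → j < k → k < b → d i k = d i j ∨ d i k = d j k}

/-- Restriction of a colouring to the pairs with `a ≤ i < j < b`. -/
def restrictPairs (a b : ℕ) (d : ℕ → ℕ → ℕ) : ℕ → ℕ → ℕ :=
  fun i j => if a ≤ i ∧ i < j ∧ j < b then d i j else 0

theorem restrictPairs_mem {a b a' b' : ℕ} {d : ℕ → ℕ → ℕ} (hd : d ∈ pairColorings a b)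
    (ha : a ≤ a') (hb : b' ≤ b) : restrictPairs a' b' d ∈ pairColorings a' b' := by
  obtain ⟨-, h1, h2⟩ := hd
  refine ⟨fun i j h => if_neg h, fun i hi hib => ?_, fun i j k hi hij hjk hk => ?_⟩
  · rw [restrictPairs, if_pos ⟨hi, by omega, hib⟩]
    exact h1 i (by omega) (by omega)
  · simp only [restrictPairs]
    rw [if_pos (by omega), if_pos (by omega), if_pos (by omega)]
    exact h2 i j k (by omega) hij hjk (by omega)

/-- Peeling off the simple pair `(j, j + 1)` shows by induction that the colour is a simple root in
the support of the coloured root. Later arguments use these bounds to exclude one alternative of the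
triple condition. -/
theorem pairColorings_bounds {a b : ℕ} {d : ℕ → ℕ → ℕ} (hd : d ∈ pairColorings a b) {i j : ℕ}
    (hi : a ≤ i) (hij : i < j) (hj : j < b) : i ≤ d i j ∧ d i j < j := by
  obtain ⟨-, h1, h2⟩ := hd
  induction j, hij using Nat.le_induction with
  | base => rw [h1 i hi hj]; omega
  | succ j hij ih =>
    have := ih (by omega)
    rcases h2 i j (j + 1) hi hij (by omega) hj with h | h
    · omega
    · rw [h, h1 j (by omega) hj]; omega

/-- All pairs that cross the colour of the longest pair get that colour. -/
theorem pairColorings_crossing {a b : ℕ} {d : ℕ → ℕ → ℕ} (hd : d ∈ pairColorings a (b + 1)) {i j : ℕ}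
    (hi : a ≤ i) (hir : i ≤ d a b) (hrj : d a b < j) (hj : j ≤ b) : d i j = d a b := by
  have key : d a j = d a b := by
    rcases hj.eq_or_lt with rfl | hjb
    · rfl
    · have := pairColorings_bounds hd (i := j) (j := b) (by omega) hjb (by omega)
      have := hd.2.2 a j b le_rfl (by omega) hjb (by omega)
      omega
  rcases hi.eq_or_lt with rfl | hai
  · exact key
  · have := pairColorings_bounds hd (i := a) (j := i) le_rfl hai (by omega)
    have := hd.2.2 a i j le_rfl hai (by omega) (by omega)
    omega

/-- Glue colourings of `[a, r]` and `[r + 1, b)`; crossing pairs get the colour `r`. -/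
def gluePairs (a b r : ℕ) (t : (ℕ → ℕ → ℕ) × (ℕ → ℕ → ℕ)) : ℕ → ℕ → ℕ :=
  fun i j => if j ≤ r then t.1 i j else if r < i then t.2 i j else
    if a ≤ i ∧ j < b then r else 0

/-- A triple whose outer pair crosses the cut has a shorter pair that crosses it too, and both have
colour `r`. All other triples lie on one side. -/
theorem gluePairs_mem {a b r : ℕ} {t : (ℕ → ℕ → ℕ) × (ℕ → ℕ → ℕ)} (har : a ≤ r) (hrb : r + 1 < b)
    (h1 : t.1 ∈ pairColorings a (r + 1)) (h2 : t.2 ∈ pairColorings (r + 1) b) :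
    gluePairs a b r t ∈ pairColorings a b := by
  obtain ⟨u1, v1, w1⟩ := h1
  obtain ⟨u2, v2, w2⟩ := h2
  refine ⟨fun i j h => ?_, fun i hi hib => ?_, fun i j k hi hij hjk hk => ?_⟩
  · have := u1 i j
    have := u2 i j
    simp only [gluePairs]
    split_ifs <;> omega
  · have := v1 i
    have := v2 i
    simp only [gluePairs]
    split_ifs <;> grind
  · have := w1 i j k hi hij hjk
    have := fun h => w2 i j k h hij hjk hk
    simp only [gluePairs]
    split_ifs <;> omega

/-- The summation index `r` is the colour of the longest pair `(a, b - 1)`. By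
`pairColorings_crossing` nothing is lost when only the two restrictions are kept. -/
theorem pairColorings_split {a b : ℕ} (hab : a + 1 < b)
    (hfin : ∀ a' b', b' - a' < b - a → (pairColorings a' b').Finite) :
    (pairColorings a b).Finite ∧ (pairColorings a b).ncard =
      ∑ r ∈ Finset.Ico a (b - 1),
        (pairColorings a (r + 1)).ncard * (pairColorings (r + 1) b).ncard := by
  have main := finite_and_ncard_eq_sum (X := pairColorings a b) (Finset.Ico a (b - 1))
    (fun r => pairColorings a (r + 1) ×ˢ pairColorings (r + 1) b) (gluePairs a b)
    (fun d => (d a (b - 1), restrictPairs a (d a (b - 1) + 1) d,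
      restrictPairs (d a (b - 1) + 1) b d)) ?_ ?_ ?_
  · simpa only [Set.ncard_prod] using main
  · intro r hr
    rw [Finset.mem_Ico] at hr
    exact (hfin _ _ (by omega)).prod (hfin _ _ (by omega))
  · rintro r hr ⟨d1, d2⟩ ⟨h1, h2⟩
    rw [Finset.mem_Ico] at hr
    refine ⟨gluePairs_mem hr.1 (by omega) h1 h2, ?_⟩
    have hr' : gluePairs a b r (d1, d2) a (b - 1) = r := by
      simp only [gluePairs]
      split_ifs <;> omega
    simp only [hr']
    refine Prod.ext rfl (Prod.ext ?_ ?_) <;> funext i j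
    · have := h1.1 i j
      simp only [restrictPairs, gluePairs]
      split_ifs <;> grind
    · have := h2.1 i j
      simp only [restrictPairs, gluePairs]
      split_ifs <;> grind
  · intro d hd
    obtain ⟨b, rfl⟩ : ∃ c, b = c + 1 := ⟨b - 1, by omega⟩
    simp only [Nat.add_sub_cancel, Finset.mem_Ico, Set.mem_prod]
    have hb := pairColorings_bounds hd (i := a) (j := b) le_rfl (by omega) (by omega)
    refine ⟨hb, ⟨restrictPairs_mem hd le_rfl (by omega),
      restrictPairs_mem hd (by omega) le_rfl⟩, ?_⟩
    funext i j
    have h0 := hd.1 i j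
    have hc := @pairColorings_crossing a b d hd i j
    simp only [restrictPairs, gluePairs]
    split_ifs <;> omega

theorem pairColorings_of_le {a b : ℕ} (h : b ≤ a + 1) : pairColorings a b = {fun _ _ => 0} := by
  ext d
  simp only [Set.mem_singleton_iff]
  constructor
  · intro hd
    funext i j
    exact hd.1 i j (by omega)
  · rintro rfl
    exact ⟨fun _ _ _ => rfl, fun i _ _ => by omega, fun _ _ _ _ _ _ _ => Or.inl rfl⟩

theorem finite_pairColorings_and_ncard (a b : ℕ) :
    (pairColorings a b).Finite ∧ (pairColorings a b).ncard = catalan (b - a - 1) := by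
  induction hn : b - a using Nat.strong_induction_on generalizing a b with
  | _ n ih =>
    subst hn
    rcases le_or_gt b (a + 1) with h | h
    · rw [pairColorings_of_le h, show b - a - 1 = 0 by omega]
      simp
    · have hs := pairColorings_split h fun a' b' h' => (ih _ h' a' b' rfl).1
      refine ⟨hs.1, hs.2.trans ?_⟩
      obtain ⟨m, rfl⟩ : ∃ m, b = a + m + 2 := ⟨b - a - 2, by omega⟩
      rw [show a + m + 2 - a - 1 = m + 1 by omega, catalan_succ, Finset.sum_Ico_eq_sum_range,
        show a + m + 2 - 1 - a = m + 1 by omega,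
        ← Fin.sum_univ_eq_sum_range (fun k => (pairColorings a (a + k + 1)).ncard *
          (pairColorings (a + k + 1) (a + m + 2)).ncard)]
      refine Finset.sum_congr rfl fun k _ => ?_
      rw [(ih _ (by omega) a (a + k + 1) rfl).2,
        (ih _ (by omega) (a + k + 1) (a + m + 2) rfl).2]
      congr 2 <;> omega

/-! ### Signed colourings and their recursion -/

/-- Symmetric colourings for the types `B` and `C`, on the indices `a ≤ i < n`: a pair `(d, p)`
where `d i j` is the colour of `ε i - ε j` and `p i j` the colour of `ε i + ε j`. -/
def signedColorings (n a : ℕ) : Set ((ℕ → ℕ → ℕ) × (ℕ → ℕ → ℕ)) :=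
  {c | c.1 ∈ pairColorings a n ∧ (∀ i j, c.2 i j = c.2 j i) ∧
    (∀ i j, ¬(a ≤ i ∧ i < n ∧ a ≤ j ∧ j < n) → c.2 i j = 0) ∧
    (a < n → c.2 (n - 1) (n - 1) = n - 1) ∧
    ∀ i j k, a ≤ i → i < j → j < n → a ≤ k → k < n → c.2 i k = c.1 i j ∨ c.2 i k = c.2 j k}

/-- Moving first one index and then the other to `n - 1` expresses the colour through values of `d`
and the prescribed colour of `(n - 1, n - 1)`. Again the colour lies in the support of the root. -/
theorem signedColorings_bounds {n a : ℕ} {d p : ℕ → ℕ → ℕ} (h : (d, p) ∈ signedColorings n a)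
    {i j : ℕ} (hi : a ≤ i) (hi' : i < n) (hj : a ≤ j) (hj' : j < n) :
    min i j ≤ p i j ∧ p i j < n := by
  obtain ⟨hd, hs, -, h1, h2⟩ := h
  simp only at hd hs h1 h2
  have key : ∀ i, a ≤ i → i < n → i ≤ p i (n - 1) ∧ p i (n - 1) < n := by
    intro i hi hi'
    rcases (show i ≤ n - 1 by omega).eq_or_lt with rfl | h
    · rw [h1 (by omega)]; omega
    · have := h2 i (n - 1) (n - 1) hi h (by omega) (by omega) (by omega)
      have := pairColorings_bounds hd hi h (by omega)
      have := h1 (by omega)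
      omega
  rcases (show i ≤ n - 1 by omega).eq_or_lt with rfl | h
  · have := key j hj hj'
    rw [hs]; omega
  · have := h2 i (n - 1) j hi h (by omega) hj hj'
    have := pairColorings_bounds hd hi h (by omega)
    have := key j hj hj'
    rw [hs j] at this
    omega

/-- Glue a colouring of `[a, S]` and a signed colouring of `[S + 1, n)`. -/
def glueSigned (n a S R : ℕ) (t : (ℕ → ℕ → ℕ) × (ℕ → ℕ → ℕ) × (ℕ → ℕ → ℕ)) :
    (ℕ → ℕ → ℕ) × (ℕ → ℕ → ℕ) :=
  (fun i j => if j ≤ S then t.1 i j else if S < i then t.2.1 i j else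
      if a ≤ i ∧ j < n then (if i ≤ R then R else S) else 0,
    fun i j => if S < i ∧ S < j then t.2.2 i j else
      if a ≤ i ∧ i < n ∧ a ≤ j ∧ j < n then
        (if (i ≤ R ∧ (j ≤ R ∨ S < j)) ∨ (j ≤ R ∧ S < i) then R else S) else 0)

/-- The condition `hR` is forced: for `i ≤ R < j ≤ S < k` the glued colours of `(i, k)` and `(j, k)`
are `R` and `S`, so if `R < S` the pair `(i, j)` must have colour `R`. -/
theorem glueSigned_mem {n a S R : ℕ} {t : (ℕ → ℕ → ℕ) × (ℕ → ℕ → ℕ) × (ℕ → ℕ → ℕ)}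
    (haR : a ≤ R) (hRS : R ≤ S) (hSn : S < n)
    (h1 : t.1 ∈ pairColorings a (S + 1)) (h2 : t.2 ∈ signedColorings n (S + 1))
    (hR : ∀ i j, a ≤ i → i ≤ R → R < j → j ≤ S → t.1 i j = R) :
    glueSigned n a S R t ∈ signedColorings n a := by
  obtain ⟨d1, d2, p2⟩ := t
  obtain ⟨u1, v1, w1⟩ := h1
  obtain ⟨⟨u2, v2, w2⟩, s2, z2, l2, t2⟩ := h2
  simp only at u1 v1 w1 u2 v2 w2 s2 z2 l2 t2 hR
  refine ⟨⟨fun i j h => ?_, fun i hi hib => ?_, fun i j k hi hij hjk hk => ?_⟩,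
    fun i j => ?_, fun i j h => ?_, fun h => ?_, fun i j k hi hij hj hk hkn => ?_⟩
  · have := u1 i j
    have := u2 i j
    simp only [glueSigned]
    split_ifs <;> omega
  · have := v1 i
    have := v2 i
    simp only [glueSigned]
    split_ifs <;> grind
  · have := w1 i j k hi hij hjk
    have := fun h => w2 i j k h hij hjk hk
    have := hR i j hi
    simp only [glueSigned]
    split_ifs <;> omega
  · have := s2 i j
    simp only [glueSigned]
    split_ifs <;> omega
  · have := z2 i j
    simp only [glueSigned]
    split_ifs <;> omega
  · simp only [glueSigned]
    split_ifs <;> omega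
  · have := fun h h' => t2 i j k h hij hj h' hkn
    have := hR i j hi
    simp only [glueSigned]
    split_ifs <;> omega

/-- Everything spreads from `p a a = R`. In each triple one alternative is too small or too large to
be the required colour, so the other holds. The indices `j > R` with `p a j = R` form an upper set,
and `S` is the last index before it. -/
theorem signedColorings_structure {n a : ℕ} {d p : ℕ → ℕ → ℕ}
    (h : (d, p) ∈ signedColorings n a) (han : a < n) :
    ∃ R S, R = p a a ∧ S = (if R + 1 < n then p a (R + 1) else R) ∧ a ≤ R ∧ R ≤ S ∧ S < n ∧
      (∀ i j, a ≤ i → i ≤ R → R < j → j < n → d i j = R) ∧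
      (∀ i j, R < i → i ≤ S → S < j → j < n → d i j = S) ∧
      (∀ i j, a ≤ i → i ≤ R → a ≤ j → (j ≤ R ∨ S < j) → j < n → p i j = R) ∧
      (∀ i j, R < i → i ≤ S → a ≤ j → j < n → p i j = S) := by
  have hb := @signedColorings_bounds n a d p h
  have hdb := @pairColorings_bounds a n d h.1
  obtain ⟨⟨-, hv, -⟩, hs, -, -, hp⟩ := id h
  have hdt := h.1.2.2
  simp only at hs hp hv hdt
  obtain ⟨R, hR⟩ : ∃ R, R = p a a := ⟨_, rfl⟩
  have hRb := hb le_rfl han le_rfl han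
  rw [← hR] at hRb
  have haR : a ≤ R := by omega
  have paR : ∀ j, a ≤ j → j ≤ R → p a j = R := by
    intro j hj hjR
    rcases hj.eq_or_lt with rfl | hj
    · exact hR.symm
    · have := hp a j a le_rfl hj (by omega) le_rfl han
      have := hdb le_rfl hj (by omega)
      have := hs a j
      omega
  have pRR : ∀ i j, a ≤ i → i ≤ R → a ≤ j → p a j = R → j < n → p i j = R := by
    intro i j hi hiR hj hpj hjn
    rcases hi.eq_or_lt with rfl | hi
    · exact hpj
    · have := hp a i j le_rfl hi (by omega) hj hjn
      have := hdb le_rfl hi (by omega)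
      omega
  have daR : ∀ j, R < j → j < n → d a j = R := by
    intro j hj hjn
    -- If `p j a = R`, comparing with `p j j ≥ j > R` still leaves `d a j = R` as the only option.
    have h1 := hp a j a le_rfl (by omega) hjn le_rfl han
    by_cases h2 : p j a = R
    · have := hp a j j le_rfl (by omega) hjn (by omega) hjn
      have := @hb j j (by omega) hjn (by omega) hjn
      have := hs a j
      omega
    · omega
  have dR : ∀ i j, a ≤ i → i ≤ R → R < j → j < n → d i j = R := by
    intro i j hi hiR hj hjn
    rcases hi.eq_or_lt with rfl | hi
    · exact daR j hj hjn
    · have := hdt a i j le_rfl hi (by omega) hjn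
      have := hdb le_rfl hi (by omega)
      have := daR j hj hjn
      omega
  have up : ∀ j j', R < j → j < j' → j' < n → p a j = R → p a j' = R := by
    intro j j' hj hjj hj' hpj
    have := hp j j' a (by omega) hjj hj' le_rfl han
    have := hdb (by omega) hjj hj'
    have := hs a j
    have := hs a j'
    omega
  by_cases hall : ∀ j, R < j → j < n → p a j = R
  · refine ⟨R, R, hR, ?_, haR, le_rfl, hRb.2, dR, fun i j _ _ _ _ => by omega,
      fun i j hi hiR hj _ hjn => pRR i j hi hiR hj ?_ hjn, fun i j _ _ _ _ => by omega⟩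
    · split_ifs with h1
      · exact (hall _ (by omega) h1).symm
      · rfl
    · rcases le_or_gt j R with h1 | h1
      · exact paR j hj h1
      · exact hall j h1 hjn
  -- `S` is the last index with `p a S ≠ R`. By `up`, no `z` with `R < z ≤ S` has `p a z = R`.
  · obtain ⟨S, ⟨hRS, hSn, hpS⟩, hmax⟩ : ∃ S, (R < S ∧ S < n ∧ p a S ≠ R) ∧
        ∀ j, S < j → j < n → p a j = R := by
      push Not at hall
      obtain ⟨j, hj⟩ := hall
      classical
      refine ⟨Nat.findGreatest (fun S => R < S ∧ S < n ∧ p a S ≠ R) n,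
        Nat.findGreatest_spec (P := fun S => R < S ∧ S < n ∧ p a S ≠ R) hj.2.1.le hj, ?_⟩
      intro k hk hkn
      by_contra hne
      have := Nat.findGreatest_spec (P := fun S => R < S ∧ S < n ∧ p a S ≠ R) hj.2.1.le hj
      exact Nat.findGreatest_is_greatest hk hkn.le ⟨by omega, hkn, hne⟩
    have ne : ∀ z, R < z → z ≤ S → p a z ≠ R := by
      intro z hz hzS hpz
      rcases hzS.eq_or_lt with rfl | hzS
      · exact hpS hpz
      · exact hpS (up z S hz hzS hSn hpz)
    have dS : ∀ z j, R < z → z ≤ S → S < j → j < n → d z j = p a z := by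
      intro z j hz hzS hj hjn
      have := hp z j a (by omega) (by omega) hjn le_rfl han
      have := ne z hz hzS
      have := hs z a
      have := hs j a
      have := hmax j hj hjn
      omega
    have pS : ∀ z j, R < z → z ≤ S → R < j → j < n → p z j = p a z := by
      intro z j hz hzS hj hjn
      have := hp a j z le_rfl (by omega) hjn (by omega) (by omega)
      have := ne z hz hzS
      have := dR a j le_rfl haR hj hjn
      have := hs z j
      omega
    -- The common colour of the middle block is found at a simple root: `(n - 1, n - 1)` if `S = n -
    -- 1`, and `(S, S + 1)` otherwise.
    have US : p a S = S := by
      rcases (show S + 1 ≤ n from hSn).eq_or_lt with h1 | h1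
      · have := pS S S hRS le_rfl hRS hSn
        have := h.2.2.2.1 han
        simp only at this
        rw [show n - 1 = S by omega] at this
        omega
      · rw [← dS S (S + 1) hRS le_rfl (by omega) h1]
        exact hv S (by omega) h1
    have paS : ∀ z, R < z → z ≤ S → p a z = S := by
      intro z hz hzS
      have := pS z S hz hzS hRS hSn
      have := pS S z hRS le_rfl hz (by omega)
      have := hs z S
      omega
    refine ⟨R, S, hR, ?_, haR, hRS.le, hSn, dR, ?_, ?_, ?_⟩
    · rw [if_pos (by omega), paS _ (by omega) (by omega)]
    · intro i j hi hiS hj hjn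
      rw [dS i j hi hiS hj hjn, paS i hi hiS]
    · intro i j hi hiR hj hj' hjn
      refine pRR i j hi hiR hj ?_ hjn
      rcases hj' with h1 | h1
      · exact paR j hj h1
      · exact hmax j h1 hjn
    · intro i j hi hiS hj hjn
      rcases le_or_gt j R with h1 | h1
      · rcases hj.eq_or_lt with rfl | hj
        · rw [hs, paS i hi hiS]
        · have := hp a j i le_rfl hj (by omega) (by omega) (by omega)
          have := hdb le_rfl hj (by omega)
          have := paS i hi hiS
          have := hs i j
          omega
      · rw [pS i j hi hiS h1 hjn, paS i hi hiS]

/-- Restriction of a symmetric function to the indices `a ≤ i, j < n`. -/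
def restrictSquare (n a : ℕ) (p : ℕ → ℕ → ℕ) : ℕ → ℕ → ℕ :=
  fun i j => if a ≤ i ∧ i < n ∧ a ≤ j ∧ j < n then p i j else 0

theorem restrictSigned_mem {n a a' : ℕ} {d p : ℕ → ℕ → ℕ} (h : (d, p) ∈ signedColorings n a)
    (ha : a ≤ a') : (restrictPairs a' n d, restrictSquare n a' p) ∈ signedColorings n a' := by
  obtain ⟨hd, hs, h0, h1, h2⟩ := h
  simp only at hd hs h0 h1 h2
  refine ⟨restrictPairs_mem hd ha le_rfl, fun i j => ?_, fun i j hij => if_neg hij,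
    fun hn => ?_, fun i j k hi hij hj hk hkn => ?_⟩
  · have := hs i j
    simp only [restrictSquare]
    split_ifs <;> omega
  · simp only [restrictSquare]
    rw [if_pos (by omega), h1 (by omega)]
  · simp only [restrictSquare, restrictPairs]
    rw [if_pos (by omega), if_pos (by omega), if_pos (by omega)]
    exact h2 i j k (by omega) hij hj (by omega) hkn

/-- The colour of `ε a + ε a`, and the end of the block of indices that is split off. -/
def splitIndex (n a : ℕ) (c : (ℕ → ℕ → ℕ) × (ℕ → ℕ → ℕ)) : ℕ :=
  if c.2 a a + 1 < n then c.2 a (c.2 a a + 1) else c.2 a a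

/-- The Boolean records whether `R = S`. If not, then `a ≤ R < S`, which explains the filter. -/
theorem signedColorings_split {n a : ℕ} (han : a < n)
    (hfin : ∀ a', a < a' → (signedColorings n a').Finite) :
    (signedColorings n a).Finite ∧ (signedColorings n a).ncard =
      ∑ i ∈ (Finset.Ico a n ×ˢ Finset.univ).filter
          (fun i : ℕ × Bool => i.2 = false → a < i.1),
        (pairColorings a (i.1 + 1)).ncard * (signedColorings n (i.1 + 1)).ncard := by
  have main := finite_and_ncard_eq_sum (X := signedColorings n a)
    ((Finset.Ico a n ×ˢ Finset.univ).filter (fun i : ℕ × Bool => i.2 = false → a < i.1))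
    (fun i => pairColorings a (i.1 + 1) ×ˢ signedColorings n (i.1 + 1))
    -- When `R < S`, the value of `R` is no extra datum: it is the colour of the longest pair `(a,
    -- S)`.
    (fun i t => glueSigned n a i.1 (if i.2 then i.1 else t.1 a i.1) t)
    (fun c => ((splitIndex n a c, decide (splitIndex n a c = c.2 a a)),
      restrictPairs a (splitIndex n a c + 1) c.1,
      restrictPairs (splitIndex n a c + 1) n c.1,
      restrictSquare n (splitIndex n a c + 1) c.2)) ?_ ?_ ?_
  · simpa only [Set.ncard_prod] using main
  · intro i hi
    simp only [Finset.mem_filter, Finset.mem_product, Finset.mem_Ico] at hi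
    exact (finite_pairColorings_and_ncard _ _).1.prod (hfin _ (by omega))
  · rintro ⟨S, b⟩ hi ⟨d1, d2, p2⟩ ⟨h1, h2⟩
    simp only [Finset.mem_filter, Finset.mem_product, Finset.mem_Ico, Finset.mem_univ,
      and_true] at hi h1 h2
    obtain ⟨R, hR⟩ : ∃ R, R = if b = true then S else d1 a S := ⟨_, rfl⟩
    simp only [← hR]
    have hRb : a ≤ R ∧ R ≤ S ∧ (b = true ↔ S = R) ∧
        ∀ i j, a ≤ i → i ≤ R → R < j → j ≤ S → d1 i j = R := by
      cases b
      · simp only [Bool.false_eq_true, if_false] at hR hi ⊢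
        have := pairColorings_bounds h1 le_rfl (hi.2 trivial) (by omega)
        refine ⟨by omega, by omega, iff_of_false id (by omega), fun i j hi hiR hj hjS => ?_⟩
        subst hR
        exact pairColorings_crossing h1 hi hiR hj hjS
      · simp only [if_true] at hR ⊢
        subst hR
        exact ⟨hi.1.1, le_rfl, by simp, fun i j _ _ _ _ => by omega⟩
    obtain ⟨haR, hRS, hbR, hd⟩ := hRb
    refine ⟨glueSigned_mem haR hRS hi.1.2 h1 h2 hd, ?_⟩
    have e1 : (glueSigned n a S R (d1, d2, p2)).2 a a = R := by
      simp only [glueSigned]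
      split_ifs <;> omega
    have e2 : splitIndex n a (glueSigned n a S R (d1, d2, p2)) = S := by
      rw [splitIndex, e1]
      simp only [glueSigned]
      split_ifs <;> omega
    rw [e1, e2]
    refine Prod.ext (Prod.ext rfl ?_) (Prod.ext ?_ (Prod.ext ?_ ?_))
    · cases b <;> simpa using hbR
    all_goals funext i j
    · have := h1.1 i j
      simp only [restrictPairs, glueSigned]
      split_ifs <;> omega
    · have := h2.1.1 i j
      simp only [restrictPairs, glueSigned]
      simp only at this
      split_ifs <;> omega
    · have := h2.2.2.1 i j
      simp only [restrictSquare, glueSigned]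
      simp only at this
      split_ifs <;> omega
  · rintro ⟨d, p⟩ h
    obtain ⟨R, S, hR, hS, haR, hRS, hSn, k1, k2, k3, k4⟩ := signedColorings_structure h han
    have e2 : splitIndex n a (d, p) = S := by
      rw [splitIndex, hS, hR]
    simp only [e2, ← hR]
    simp only [Finset.mem_filter, Finset.mem_product, Finset.mem_Ico, Finset.mem_univ,
      and_true, Set.mem_prod]
    refine ⟨⟨⟨by omega, hSn⟩, fun hne => ?_⟩,
      ⟨restrictPairs_mem h.1 le_rfl (by omega), restrictSigned_mem h (by omega)⟩, ?_⟩
    · simp only [decide_eq_false_iff_not] at hne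
      omega
    · have e3 : (if decide (S = R) = true then S else restrictPairs a (S + 1) d a S) = R := by
        by_cases hSR : S = R
        · simp [hSR]
        · simp only [hSR, decide_false, Bool.false_eq_true, if_false, restrictPairs]
          rw [if_pos (by omega)]
          exact k1 a S le_rfl haR (by omega) hSn
      rw [e3]
      refine Prod.ext ?_ ?_ <;> funext i j
      · have h0 := h.1.1 i j
        have := k1 i j
        have := k2 i j
        simp only at h0
        simp only [restrictPairs, glueSigned]
        split_ifs <;> omega
      · have h0 := h.2.2.1 i j
        have hs := h.2.1 i j
        simp only at h0 hs
        have := k3 i j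
        have := k4 i j
        have := k3 j i
        have := k4 j i
        simp only [restrictSquare, glueSigned]
        split_ifs <;> omega

/-- The number of signed colourings on `n` indices. -/
def signedCatalan : ℕ → ℕ
  | 0 => 1
  | n + 1 => ∑ s : Fin (n + 1), catalan s * signedCatalan (n - s) +
      ∑ s : Fin (n + 1), if (s : ℕ) = 0 then 0 else catalan s * signedCatalan (n - s)
  decreasing_by all_goals omega

theorem signedCatalan_zero : signedCatalan 0 = 1 := by
  rw [signedCatalan]

theorem signedCatalan_succ (n : ℕ) : signedCatalan (n + 1) =
    ∑ s ∈ Finset.range (n + 1), catalan s * signedCatalan (n - s) +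
      ∑ s ∈ Finset.range (n + 1), if s = 0 then 0 else catalan s * signedCatalan (n - s) := by
  rw [signedCatalan,
    ← Fin.sum_univ_eq_sum_range (fun s => catalan s * signedCatalan (n - s)),
    ← Fin.sum_univ_eq_sum_range (fun s => if s = 0 then 0 else catalan s * signedCatalan (n - s))]

theorem finite_signedColorings_and_ncard (n a : ℕ) :
    (signedColorings n a).Finite ∧ (signedColorings n a).ncard = signedCatalan (n - a) := by
  induction hm : n - a using Nat.strong_induction_on generalizing a with
  | _ m ih =>
    subst hm
    rcases le_or_gt n a with h | h
    · have : signedColorings n a = {(fun _ _ => 0, fun _ _ => 0)} := by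
        ext c
        simp only [Set.mem_singleton_iff]
        constructor
        · intro hc
          refine Prod.ext ?_ ?_ <;> funext i j
          · exact hc.1.1 i j (by omega)
          · exact hc.2.2.1 i j (by omega)
        · rintro rfl
          refine ⟨?_, fun _ _ => rfl, fun _ _ _ => rfl, fun _ => by omega,
            fun _ _ _ _ _ _ _ _ => Or.inl rfl⟩
          rw [pairColorings_of_le (by omega)]
          rfl
      rw [this, show n - a = 0 by omega, signedCatalan_zero]
      simp
    · have hs := signedColorings_split h fun a' h' => (ih _ (by omega) a' rfl).1
      refine ⟨hs.1, hs.2.trans ?_⟩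
      obtain ⟨m, rfl⟩ : ∃ m, n = a + m + 1 := ⟨n - a - 1, by omega⟩
      rw [show a + m + 1 - a = m + 1 by omega, signedCatalan_succ, Finset.sum_filter,
        Finset.sum_product, Finset.sum_Ico_eq_sum_range, show a + m + 1 - a = m + 1 by omega,
        ← Finset.sum_add_distrib]
      refine Finset.sum_congr rfl fun s hs => ?_
      rw [Finset.mem_range] at hs
      simp only [Fintype.sum_bool, reduceCtorEq, false_imp_iff, if_true, forall_const]
      rw [(finite_pairColorings_and_ncard _ _).2, (ih _ (by omega) (a + s + 1) rfl).2,
        show a + s + 1 - a - 1 = s by omega, show a + m + 1 - (a + s + 1) = m - s by omega]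
      rcases s.eq_zero_or_pos with rfl | h0
      · simp
      · rw [if_pos (by omega), if_neg (by omega)]

/-! ### From decompositions to colourings, and from colour classes to permutations -/

/-- Decompositions into inversion sets with exactly one simple root each correspond to colourings
of the positive roots by simple roots all of whose colour classes are inversion sets. -/
theorem ncard_decompositions {R Q ι γ : Type*} [Inhabited ι] {invs : Set (Set R)} {P : Set R} {Q₀ : Set Q}
    {ρ : Q → R} (hρ : Set.InjOn ρ Q₀) (hP : ρ '' Q₀ = P) {L : Set ι} {s : ι → Q}
    (hs : ∀ l ∈ L, s l ∈ Q₀) (hsinj : Set.InjOn s L) {X : Set γ} {F : γ → Q → ι}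
    (hX : ∀ c ∈ X, (∀ q ∈ Q₀, F c q ∈ L) ∧ (∀ l ∈ L, F c (s l) = l) ∧
      ∀ l ∈ L, ρ '' {q | q ∈ Q₀ ∧ F c q = l} ∈ invs)
    (hinj : ∀ c ∈ X, ∀ c' ∈ X, (∀ q ∈ Q₀, F c q = F c' q) → c = c')
    (hsurj : ∀ f : Q → ι, (∀ q ∈ Q₀, f q ∈ L) → (∀ l ∈ L, f (s l) = l) →
      (∀ l ∈ L, ρ '' {q | q ∈ Q₀ ∧ f q = l} ∈ invs) → ∃ c ∈ X, ∀ q ∈ Q₀, F c q = f q) :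
    {D | IsDecomposition invs P D ∧ ∀ Φ ∈ D, ∃! α, α ∈ Φ ∧ α ∈ (fun l => ρ (s l)) '' L}.ncard =
      X.ncard := by
  classical
  symm
  have hmem : ∀ {q : Q} {f : Q → ι} {l : ι}, q ∈ Q₀ →
      (ρ q ∈ ρ '' {q | q ∈ Q₀ ∧ f q = l} ↔ f q = l) := by
    intro q f l hq
    constructor
    · rintro ⟨q', ⟨hq', h⟩, he⟩
      rwa [← hρ hq' hq he]
    · exact fun h => ⟨q, ⟨hq, h⟩, rfl⟩
  refine Set.ncard_congr
    (fun c _ => (fun l => ρ '' {q | q ∈ Q₀ ∧ F c q = l}) '' L) ?_ ?_ ?_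
  · intro c hc
    obtain ⟨h1, h2, h3⟩ := hX c hc
    refine ⟨⟨?_, ?_, ?_⟩, ?_⟩
    · rintro _ ⟨l, hl, rfl⟩
      exact h3 l hl
    · rintro _ ⟨l, hl, rfl⟩ _ ⟨l', hl', rfl⟩ hne
      refine Set.disjoint_left.mpr ?_
      rintro _ ⟨q, ⟨hq, rfl⟩, rfl⟩ hq'
      simp only [id] at hq'
      rw [hmem hq] at hq'
      exact hne (by rw [hq'])
    · ext v
      simp only [← hP, Set.mem_sUnion]
      constructor
      · rintro ⟨_, ⟨l, -, rfl⟩, ⟨q, hq, rfl⟩⟩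
        exact ⟨q, hq.1, rfl⟩
      · rintro ⟨q, hq, rfl⟩
        exact ⟨_, ⟨F c q, h1 q hq, rfl⟩, q, ⟨hq, rfl⟩, rfl⟩
    · rintro _ ⟨l, hl, rfl⟩
      refine ⟨ρ (s l), ⟨(hmem (hs l hl)).2 (h2 l hl), l, hl, rfl⟩, ?_⟩
      rintro _ ⟨h, ⟨l', hl', rfl⟩⟩
      rw [hmem (hs l' hl'), h2 l' hl'] at h
      rw [h]
  · intro c c' hc hc' h
    refine hinj c hc c' hc' fun q hq => ?_
    obtain ⟨h1, h2, -⟩ := hX c hc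
    obtain ⟨-, h2', -⟩ := hX c' hc'
    have hl := h1 q hq
    obtain ⟨l', hl', he⟩ : ρ '' {q' | q' ∈ Q₀ ∧ F c q' = F c q} ∈
        (fun l => ρ '' {q | q ∈ Q₀ ∧ F c' q = l}) '' L := by
      rw [← h]
      exact ⟨_, hl, rfl⟩
    simp only at he
    have e1 : ρ (s (F c q)) ∈ ρ '' {q | q ∈ Q₀ ∧ F c' q = l'} := by
      rw [he, hmem (hs _ hl), h2 _ hl]
    rw [hmem (hs _ hl), h2' _ hl] at e1
    have e2 : ρ q ∈ ρ '' {q | q ∈ Q₀ ∧ F c' q = l'} := by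
      rw [he, hmem hq]
    rw [hmem hq] at e2
    rw [e1, e2]
  · rintro D ⟨⟨hD1, hD2, hD3⟩, hD4⟩
    -- The colour of `q` is the simple root in the block of `ρ q`; outside `Q₀` the value is
    -- irrelevant.
    have hex : ∀ q, ∃ l, q ∈ Q₀ → l ∈ L ∧ ∃ Φ ∈ D, ρ q ∈ Φ ∧ ρ (s l) ∈ Φ := by
      intro q
      by_cases hq : q ∈ Q₀
      · have : ρ q ∈ ⋃₀ D := by
          rw [hD3, ← hP]
          exact ⟨q, hq, rfl⟩
        obtain ⟨Φ, hΦ, hqΦ⟩ := this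
        obtain ⟨_, ⟨h, l, hl, rfl⟩, -⟩ := hD4 Φ hΦ
        exact ⟨l, fun _ => ⟨hl, Φ, hΦ, hqΦ, h⟩⟩
      · exact ⟨default, fun h => absurd h hq⟩
    choose f hf using hex
    have same : ∀ {Φ Ψ v}, Φ ∈ D → Ψ ∈ D → v ∈ Φ → v ∈ Ψ → Φ = Ψ := by
      intro Φ Ψ v hΦ hΨ h1 h2
      by_contra hne
      exact Set.disjoint_left.mp (hD2 hΦ hΨ hne) h1 h2
    have uniq : ∀ {Φ l l'}, Φ ∈ D → l ∈ L → l' ∈ L → ρ (s l) ∈ Φ → ρ (s l') ∈ Φ →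
        l = l' := by
      intro Φ l l' hΦ hl hl' h1 h2
      refine hsinj hl hl' <| hρ (hs l hl) (hs l' hl')
        ((hD4 Φ hΦ).unique ⟨h1, l, hl, rfl⟩ ⟨h2, l', hl', rfl⟩)
    have hclass : ∀ {Φ l}, Φ ∈ D → l ∈ L → ρ (s l) ∈ Φ → ρ '' {q | q ∈ Q₀ ∧ f q = l} = Φ := by
      intro Φ l hΦ hl hlΦ
      ext v
      constructor
      · rintro ⟨q, ⟨hq, rfl⟩, rfl⟩
        obtain ⟨-, Ψ, hΨ, h1, h2⟩ := hf q hq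
        rwa [same hΦ hΨ hlΦ h2]
      · intro hv
        have hvP : v ∈ ρ '' Q₀ := by
          rw [hP, ← hD3]
          exact ⟨Φ, hΦ, hv⟩
        obtain ⟨q, hq, rfl⟩ := hvP
        obtain ⟨hfq, Ψ, hΨ, h1, h2⟩ := hf q hq
        rw [← same hΦ hΨ hv h1] at h2
        exact ⟨q, ⟨hq, uniq hΦ hfq hl h2 hlΦ⟩, rfl⟩
    obtain ⟨c, hc, hcf⟩ := hsurj f (fun q hq => (hf q hq).1)
      (fun l hl => by
        obtain ⟨h0, Φ, hΦ, h1, h2⟩ := hf (s l) (hs l hl)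
        exact uniq hΦ h0 hl h2 h1)
      (fun l hl => by
        obtain ⟨h0, Φ, hΦ, h1, h2⟩ := hf (s l) (hs l hl)
        rw [hclass hΦ hl h1]
        exact hD1 hΦ)
    refine ⟨c, hc, ?_⟩
    have hcl : ∀ l, ρ '' {q | q ∈ Q₀ ∧ F c q = l} = ρ '' {q | q ∈ Q₀ ∧ f q = l} := by
      intro l
      congr 1
      ext q
      simp only [Set.mem_ofPred_eq, and_congr_right_iff]
      intro hq
      rw [hcf q hq]
    simp only [hcl]
    ext Φ
    constructor
    · rintro ⟨l, hl, rfl⟩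
      obtain ⟨-, Φ, hΦ, h1, -⟩ := hf (s l) (hs l hl)
      simpa only [hclass hΦ hl h1] using hΦ
    · intro hΦ
      obtain ⟨_, ⟨h, l, hl, rfl⟩, -⟩ := hD4 Φ hΦ
      exact ⟨l, hl, hclass hΦ hl h⟩

open Classical in
/-- A colour class of a colouring of the pairs in `[0, N)` is the inversion set of a permutation
`g`, which commutes with the reversal if the colouring does. -/
theorem exists_rank {N : ℕ} {c : ℕ → ℕ → ℕ}
    (hc : ∀ x y z, x < y → y < z → z < N → c x z = c x y ∨ c x z = c y z) (l : ℕ) :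
    ∃ g : ℕ → ℕ, (∀ x < N, g x < N) ∧ (∀ x y, x < y → y < N → (g y < g x ↔ c x y = l)) ∧
      (∀ x < N, ∀ y < N, g x = g y → x = y) ∧
      ((∀ x y, x < y → y < N → c (N - 1 - y) (N - 1 - x) = c x y) →
        ∀ x < N, g (N - 1 - x) = N - 1 - g x) := by
  -- `r` is the natural order with the pairs of colour `l` reversed. A 3-cycle would violate `hc`,
  -- so `r` is a linear order on `[0, N)`, and `g x` will be the number of predecessors of `x`.
  obtain ⟨r, hr⟩ : ∃ r : ℕ → ℕ → Prop, ∀ x y, r x y ↔ (x < y ∧ c x y ≠ l) ∨ (y < x ∧ c y x = l) :=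
    ⟨_, fun _ _ => Iff.rfl⟩
  have irr : ∀ x, ¬ r x x := by
    intro x
    rw [hr]
    omega
  have tot : ∀ x y, x ≠ y → r x y ∨ r y x := by
    intro x y h
    rw [hr, hr]
    by_cases c x y = l <;> by_cases c y x = l <;> omega
  have trans : ∀ x y z, x < N → y < N → z < N → r x y → r y z → r x z := by
    intro x y z hx hy hz
    have := hc x y z
    have := hc x z y
    have := hc y x z
    have := hc y z x
    have := hc z x y
    have := hc z y x
    rw [hr, hr, hr]
    grind
  have asymm : ∀ x y, x < N → y < N → r x y → ¬ r y x :=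
    fun x y hx hy h h' => irr x (trans x y x hx hy hx h h')
  have mono : ∀ x y, x < N → y < N → r x y →
      ((Finset.range N).filter (r · x)).card < ((Finset.range N).filter (r · y)).card := by
    intro x y hx hy h
    refine Finset.card_lt_card ((Finset.ssubset_iff_of_subset ?_).2 ⟨x, ?_, ?_⟩)
    · intro z hz
      simp only [Finset.mem_filter, Finset.mem_range] at hz ⊢
      exact ⟨hz.1, trans z x y hz.1 hx hy hz.2 h⟩
    · simp [hx, h]
    · simp [irr]
  have lt_iff : ∀ x y, x < N → y < N → (((Finset.range N).filter (r · x)).card <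
      ((Finset.range N).filter (r · y)).card ↔ r x y) := by
    intro x y hx hy
    refine ⟨fun h => ?_, mono x y hx hy⟩
    by_contra hn
    rcases eq_or_ne x y with rfl | hne
    · exact lt_irrefl _ h
    · exact lt_asymm h (mono y x hy hx ((tot x y hne).resolve_left hn))
  refine ⟨fun x => ((Finset.range N).filter (r · x)).card, fun x hx => ?_, fun x y hxy hy => ?_,
    fun x hx y hy h => ?_, fun hsym x hx => ?_⟩
  · refine (Finset.card_lt_card ((Finset.ssubset_iff_of_subset (Finset.filter_subset _ _)).2
      ⟨x, ?_, ?_⟩)).trans_eq (Finset.card_range N)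
    · simpa using hx
    · simp [irr]
  · rw [lt_iff y x hy (by omega), hr]
    omega
  · by_contra hne
    rcases tot x y hne with h' | h'
    · exact (mono x y hx hy h').ne h
    · exact (mono y x hy hx h').ne' h
  · have e1 : ((Finset.range N).filter (r · (N - 1 - x))).card =
        ((Finset.range N).filter (r x ·)).card := by
      refine Finset.card_bij (fun z _ => N - 1 - z) ?_ ?_ ?_
      · intro z hz
        simp only [Finset.mem_filter, Finset.mem_range] at hz ⊢
        refine ⟨by omega, ?_⟩
        have h1 := hsym z (N - 1 - x)
        have h2 := hsym (N - 1 - x) z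
        rw [show N - 1 - (N - 1 - x) = x by omega] at h1 h2
        have := hz.2
        rw [hr] at this ⊢
        omega
      · intro z hz z' hz' h
        simp only [Finset.mem_filter, Finset.mem_range] at hz hz'
        omega
      · intro z hz
        simp only [Finset.mem_filter, Finset.mem_range] at hz ⊢
        refine ⟨N - 1 - z, ⟨by omega, ?_⟩, by omega⟩
        have h1 := hsym x z
        have h2 := hsym z x
        have := hz.2
        rw [hr] at this ⊢
        omega
    have e2 : ((Finset.range N).filter (r · x)).card + ((Finset.range N).filter (r x ·)).card + 1 =
        N := by
      have h1 : Disjoint ((Finset.range N).filter (r · x)) ((Finset.range N).filter (r x ·)) := by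
        rw [Finset.disjoint_filter]
        intro z hz
        exact asymm z x (Finset.mem_range.1 hz) hx
      have h2 : (Finset.range N).filter (r · x) ∪ (Finset.range N).filter (r x ·) =
          (Finset.range N).erase x := by
        ext z
        simp only [Finset.mem_union, Finset.mem_filter, Finset.mem_range, Finset.mem_erase]
        constructor
        · rintro (⟨hz, h⟩ | ⟨hz, h⟩)
          · exact ⟨fun he => irr x (he ▸ h), hz⟩
          · exact ⟨fun he => irr x (he ▸ h), hz⟩
        · rintro ⟨hne, hz⟩
          rcases tot z x hne with h | h
          · exact Or.inl ⟨hz, h⟩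
          · exact Or.inr ⟨hz, h⟩
      rw [← Finset.card_union_of_disjoint h1, h2, Finset.card_erase_add_one (by simpa using hx),
        Finset.card_range]
    simp only [e1]
    omega

/-! ### Decompositions in type A -/

/-- The `l`-th simple root of type `A_m`. -/
def simpleA (m l : ℕ) : Fin (m + 1) × Fin (m + 1) :=
  (Fin.ofNat (m + 1) l, Fin.ofNat (m + 1) (l + 1))

theorem simpleA_val {m l : ℕ} (h : l < m) :
    ((simpleA m l).1 : ℕ) = l ∧ ((simpleA m l).2 : ℕ) = l + 1 := by
  simp only [simpleA, Fin.ofNat]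
  exact ⟨Nat.mod_eq_of_lt (by omega), Nat.mod_eq_of_lt (by omega)⟩

theorem simpleA_mem {m l : ℕ} (h : l < m) : simpleA m l ∈ posRootsA (m + 1) := by
  have := simpleA_val h
  rw [posRootsA, Set.mem_ofPred_eq, Fin.lt_def]
  omega

theorem simpleA_injOn (m : ℕ) : Set.InjOn (simpleA m) (Set.Iio m) := by
  intro l hl l' hl' h
  have := simpleA_val hl
  have := simpleA_val hl'
  rw [h] at *
  omega

/-- A permutation without descents at adjacent positions is strictly increasing and has no
inversions. -/
theorem exists_simpleA_mem_invA {m : ℕ} {σ : Equiv.Perm (Fin (m + 1))} (h : (invA σ).Nonempty) :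
    ∃ l < m, simpleA m l ∈ invA σ := by
  by_contra! hn
  have hmono : StrictMono σ := by
    rw [Fin.strictMono_iff_lt_succ]
    intro i
    have h1 := hn i i.2
    have h2 := simpleA_val i.2
    have e1 : (simpleA m i).1 = i.castSucc := Fin.ext (by simpa using h2.1)
    have e2 : (simpleA m i).2 = i.succ := Fin.ext (by simpa using h2.2)
    have h3 : ¬ σ (simpleA m i).2 < σ (simpleA m i).1 := fun h => h1 ⟨simpleA_mem i.2, h⟩
    rw [e1, e2] at h3
    refine lt_of_le_of_ne (not_lt.1 h3) fun h => ?_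
    exact (Fin.castSucc_lt_succ (i := i)).ne (σ.injective h)
  obtain ⟨q, hq, hlt⟩ := h
  exact lt_asymm hlt (hmono hq)

/-- A decomposition into `m` non-empty inversion sets has exactly one simple root in each. -/
theorem decompositionA_iff {m : ℕ} {D : Set (Set (Fin (m + 1) × Fin (m + 1)))}
    (hD : IsDecomposition (Set.range (invA (n := m + 1))) (posRootsA (m + 1)) D) :
    ((∀ Φ ∈ D, Φ.Nonempty) ∧ D.ncard = m) ↔
      ∀ Φ ∈ D, ∃! α, α ∈ Φ ∧ α ∈ (fun l => id (simpleA m l)) '' Set.Iio m := by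
  have same : ∀ {Φ Ψ v}, Φ ∈ D → Ψ ∈ D → v ∈ Φ → v ∈ Ψ → Φ = Ψ := by
    intro Φ Ψ v hΦ hΨ h1 h2
    by_contra hne
    exact Set.disjoint_left.mp (hD.disjoint hΦ hΨ hne) h1 h2
  have hcov : ∀ l, ∃ Φ, l < m → Φ ∈ D ∧ simpleA m l ∈ Φ := by
    intro l
    by_cases hl : l < m
    · have : simpleA m l ∈ ⋃₀ D := by
        rw [hD.sUnion_eq]
        exact simpleA_mem hl
      obtain ⟨Φ, hΦ, h⟩ := this
      exact ⟨Φ, fun _ => ⟨hΦ, h⟩⟩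
    · exact ⟨∅, fun h => absurd h hl⟩
  choose B hB using hcov
  have hfin : D.Finite := Set.toFinite D
  have himg : (∀ Φ ∈ D, Φ.Nonempty) → B '' (Set.Iio m) = D := by
    intro hne
    ext Φ
    constructor
    · rintro ⟨l, hl, rfl⟩
      exact (hB l hl).1
    · intro hΦ
      obtain ⟨σ, rfl⟩ := hD.subset_inv hΦ
      obtain ⟨l, hl, h⟩ := exists_simpleA_mem_invA (hne _ hΦ)
      exact ⟨l, hl, same (hB l hl).1 hΦ (hB l hl).2 h⟩
  constructor
  · rintro ⟨hne, hcard⟩ Φ hΦ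
    have him := himg hne
    -- `B` maps `m` simple roots onto `m` blocks, so no block receives two of them.
    have hinj : Set.InjOn B (Set.Iio m) := by
      refine (Set.ncard_image_iff (Set.finite_Iio m)).1 ?_
      rw [him, hcard, Set.ncard_eq_toFinset_card']
      simp
    rw [← him] at hΦ
    obtain ⟨l, hl, rfl⟩ := hΦ
    refine ⟨simpleA m l, ⟨(hB l hl).2, l, hl, rfl⟩, ?_⟩
    rintro _ ⟨h, l', hl', rfl⟩
    have := same (hB l' hl').1 (hB l hl).1 (hB l' hl').2 h
    rw [hinj hl' hl this]
    rfl
  · intro h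
    have hne : ∀ Φ ∈ D, Φ.Nonempty := fun Φ hΦ => by
      obtain ⟨α, hα, -⟩ := h Φ hΦ
      exact ⟨α, hα.1⟩
    refine ⟨hne, ?_⟩
    rw [← himg hne, Set.InjOn.ncard_image, Set.ncard_eq_toFinset_card']
    · simp
    · intro l hl l' hl' he
      refine simpleA_injOn m hl hl' ((h _ (hB l hl).1).unique ⟨(hB l hl).2, l, hl, rfl⟩
        ⟨?_, l', hl', rfl⟩)
      rw [he]
      exact (hB l' hl').2

/-- The colour classes are inversion sets if and only if the colouring satisfies the condition on
triples. -/
theorem exists_invA_eq {m : ℕ} {c : ℕ → ℕ → ℕ}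
    (hc : ∀ x y z, x < y → y < z → z < m + 1 → c x z = c x y ∨ c x z = c y z) (l : ℕ) :
    {q | q ∈ posRootsA (m + 1) ∧ c q.1 q.2 = l} ∈ Set.range (invA (n := m + 1)) := by
  obtain ⟨g, hg1, hg2, hg3, -⟩ := exists_rank hc l
  let f : Fin (m + 1) → Fin (m + 1) := fun i => ⟨g i, hg1 i i.2⟩
  have hf : Function.Injective f := fun i j h =>
    Fin.ext (hg3 i i.2 j j.2 (congrArg Fin.val h))
  refine ⟨Equiv.ofBijective f (Finite.injective_iff_bijective.1 hf), ?_⟩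
  ext ⟨i, j⟩
  simp only [invA, Set.mem_ofPred_eq, Equiv.ofBijective_apply, and_congr_right_iff, f,
    Fin.mk_lt_mk]
  intro h
  exact hg2 i j h j.2

/-- Let `σ` have the class of `(i, k)` as inversion set. Since `σ k < σ i`, either `σ j < σ i` or `σ
k < σ j`. -/
theorem triple_of_invA {m : ℕ} {f : Fin (m + 1) × Fin (m + 1) → ℕ}
    (hf : ∀ q ∈ posRootsA (m + 1), f q ∈ Set.Iio m)
    (hinv : ∀ l ∈ Set.Iio m, id '' {q | q ∈ posRootsA (m + 1) ∧ f q = l} ∈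
      Set.range (invA (n := m + 1))) {i j k : Fin (m + 1)} (hij : i < j) (hjk : j < k) :
    f (i, k) = f (i, j) ∨ f (i, k) = f (j, k) := by
  have hik : (i, k) ∈ posRootsA (m + 1) := hij.trans hjk
  obtain ⟨σ, hσ⟩ := hinv _ (hf _ hik)
  rw [Set.image_id] at hσ
  have h1 : (i, k) ∈ invA σ := by
    rw [hσ]
    exact ⟨hik, rfl⟩
  rcases lt_or_ge (σ j) (σ i) with h | h
  · have h2 : (i, j) ∈ invA σ := ⟨hij, h⟩
    rw [hσ] at h2
    exact Or.inl h2.2.symm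
  · have h2 : (j, k) ∈ invA σ := ⟨hjk, h1.2.trans_le h⟩
    rw [hσ] at h2
    exact Or.inr h2.2.symm

theorem catA_eq_catalan (m : ℕ) : catA m = catalan m := by
  have h1 := (finite_pairColorings_and_ncard 0 (m + 1)).2
  rw [show m + 1 - 0 - 1 = m by omega] at h1
  rw [← h1, catA, ← ncard_decompositions (invs := Set.range (invA (n := m + 1)))
    (P := posRootsA (m + 1)) (ρ := id) (Q₀ := posRootsA (m + 1)) (L := Set.Iio m)
    (s := simpleA m) (X := pairColorings 0 (m + 1)) (F := fun d q => d q.1 q.2) (Set.injOn_id _) (Set.image_id _)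
    (fun l hl => simpleA_mem hl) (simpleA_injOn m)]
  · congr 1
    ext D
    exact and_congr_right fun hD => decompositionA_iff hD
  · intro d hd
    refine ⟨fun q hq => ?_, fun l hl => ?_, fun l hl => ?_⟩
    · have := pairColorings_bounds hd (Nat.zero_le _) hq q.2.2
      simp only [Set.mem_Iio]
      omega
    · have h := simpleA_val hl
      simp only [h.1, h.2]
      exact hd.2.1 l (Nat.zero_le _) (Nat.succ_lt_succ hl)
    · rw [Set.image_id]
      exact exists_invA_eq (fun x y z hxy hyz hz => hd.2.2 x y z (Nat.zero_le _) hxy hyz hz) l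
  · intro d hd d' hd' h
    funext i j
    by_cases hij : i < j ∧ j < m + 1
    · exact h (⟨i, by omega⟩, ⟨j, hij.2⟩) hij.1
    · rw [hd.1 i j (by omega), hd'.1 i j (by omega)]
  · intro f hf1 hf2 hf3
    refine ⟨fun i j => if i < j ∧ j < m + 1 then f (Fin.ofNat _ i, Fin.ofNat _ j) else 0,
      ⟨fun i j h => if_neg (by omega), fun i _ hi => ?_, fun i j k _ hij hjk hk => ?_⟩, ?_⟩
    · simp only
      rw [if_pos ⟨by omega, hi⟩]
      exact hf2 i (by simpa using hi)
    · simp only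
      rw [if_pos (by omega), if_pos (by omega), if_pos (by omega)]
      refine triple_of_invA hf1 hf3 ?_ ?_ <;> rw [Fin.lt_def] <;> simp only [Fin.ofNat] <;>
        rw [Nat.mod_eq_of_lt (by omega), Nat.mod_eq_of_lt (by omega)] <;> assumption
    · rintro ⟨i, j⟩ hij
      simp only
      rw [if_pos ⟨hij, j.2⟩]
      simp

/-! ### Roots and signed permutations in types B and C -/

/-- The linear functional whose sign tells positive roots from negative ones. -/
def level (n : ℕ) : V n →ₗ[ℤ] ℤ := ∑ t : Fin n, ((n : ℤ) - t) • LinearMap.proj t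

theorem level_ε {n : ℕ} (i : Fin n) : level n (ε i) = n - i := by
  simp [level, ε, Pi.single_apply]

/-- The vector `ε i`, for an index `i : ℕ`; it is `0` for `n ≤ i`. -/
def unit (n i : ℕ) : V n := fun t => if (t : ℕ) = i then 1 else 0

theorem unit_val {n : ℕ} (i : Fin n) : unit n i = ε i := by
  funext t
  simp [unit, ε, Pi.single_apply, Fin.ext_iff]

/-- Indices of the positive roots: `(false, i, j)` stands for `ε i - ε j` and `(true, i, j)` for
`ε i + ε j`, or for the multiple `κ • ε i` of `ε i` in case `i = j`. -/
def rootIndices (n : ℕ) : Set (Bool × ℕ × ℕ) :=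
  {q | q.2.2 < n ∧ (q.2.1 < q.2.2 ∨ q.1 = true ∧ q.2.1 = q.2.2)}

/-- The positive root with a given index. -/
def root (n : ℕ) (κ : ℤ) (q : Bool × ℕ × ℕ) : V n :=
  if q.1 then (if q.2.1 = q.2.2 then κ • unit n q.2.1 else unit n q.2.1 + unit n q.2.2)
  else unit n q.2.1 - unit n q.2.2

theorem root_apply_fst_pos {n : ℕ} {κ : ℤ} (hκ : 0 < κ) {q : Bool × ℕ × ℕ}
    (hq : q ∈ rootIndices n) {t : Fin n} (ht : (t : ℕ) = q.2.1) : 0 < root n κ q t := by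
  obtain ⟨b, i, j⟩ := q
  obtain ⟨-, h⟩ := hq
  simp only at h ht
  simp only [root]
  split_ifs with h1 h2
  · simp [unit, ht, hκ]
  · simp [unit, ht, h2]
  · simp [unit, ht, (show i ≠ j by simp_all; omega)]

theorem root_apply_of_ne {n : ℕ} {κ : ℤ} {q : Bool × ℕ × ℕ} (hq : q ∈ rootIndices n) {t : Fin n}
    (ht : (t : ℕ) ≠ q.2.1) :
    root n κ q t = if (t : ℕ) = q.2.2 then (if q.1 then 1 else -1) else 0 := by
  obtain ⟨b, i, j⟩ := q
  obtain ⟨-, h⟩ := hq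
  simp only at h ht
  simp only [root]
  split_ifs with h1 h2 <;> simp_all [unit]

/-- The first index is the first nonzero coordinate of the root. Once the first indices agree, the
other coordinates determine the second index and the sign. -/
theorem root_injOn (n : ℕ) {κ : ℤ} (hκ : 0 < κ) : Set.InjOn (root n κ) (rootIndices n) := by
  have hle : ∀ q ∈ rootIndices n, q.2.1 ≤ q.2.2 ∧ q.2.2 < n := fun q hq =>
    ⟨hq.2.elim le_of_lt fun h => h.2.le, hq.1⟩
  have fst_le : ∀ q ∈ rootIndices n, ∀ q' ∈ rootIndices n, root n κ q = root n κ q' →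
      q'.2.1 ≤ q.2.1 := by
    intro q hq q' hq' h
    have h1 := hle q hq
    have h2 := hle q' hq'
    by_contra hlt
    have h3 := root_apply_fst_pos hκ hq (t := ⟨q.2.1, by omega⟩) rfl
    rw [h, root_apply_of_ne hq' (by simp only; omega), if_neg (by simp only; omega)] at h3
    omega
  have snd_eq : ∀ q ∈ rootIndices n, ∀ q' ∈ rootIndices n, root n κ q = root n κ q' →
      q.2.1 < q.2.2 → q = q' := by
    intro q hq q' hq' h hlt
    have e := (fst_le q' hq' q hq h.symm).antisymm (fst_le q hq q' hq' h)
    have h3 := congrFun h ⟨q.2.2, hq.1⟩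
    rw [root_apply_of_ne hq (by simp only; omega),
      root_apply_of_ne hq' (by simp only; omega), if_pos rfl] at h3
    obtain ⟨b, i, j⟩ := q
    obtain ⟨b', i', j'⟩ := q'
    simp only at h3 e
    split_ifs at h3 <;> simp_all
  intro q hq q' hq' h
  rcases hq.2 with h1 | h1
  · exact snd_eq q hq q' hq' h h1
  · rcases hq'.2 with h2 | h2
    · exact (snd_eq q' hq' q hq h.symm h2).symm
    · have e := (fst_le q' hq' q hq h.symm).antisymm (fst_le q hq q' hq' h)
      exact Prod.ext (h1.1.trans h2.1.symm) (Prod.ext e (by rw [← h1.2, ← h2.2, e]))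

/-- The positive roots of type `B` (for `κ = 1`) or `C` (for `κ = 2`). -/
def posRoots (n : ℕ) (κ : ℤ) : Set (V n) := root n κ '' rootIndices n

/-- The index of the `l`-th simple root. -/
def simpleIndex (n l : ℕ) : Bool × ℕ × ℕ :=
  if l + 1 = n then (true, l, l) else (false, l, l + 1)

theorem simpleIndex_mem {n l : ℕ} (h : l < n) : simpleIndex n l ∈ rootIndices n := by
  rw [simpleIndex]
  split_ifs with h1
  · exact ⟨h, Or.inr ⟨rfl, rfl⟩⟩
  · exact ⟨by simp only; omega, Or.inl (by simp)⟩

theorem simpleIndex_injective (n : ℕ) : Function.Injective (simpleIndex n) := by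
  intro l l' h
  simp only [simpleIndex] at h
  split_ifs at h <;> simp_all

theorem root_false {n : ℕ} (κ : ℤ) (i j : Fin n) : root n κ (false, i, j) = ε i - ε j := by
  simp [root, unit_val]

theorem root_true {n : ℕ} (κ : ℤ) {i j : Fin n} (h : i ≠ j) :
    root n κ (true, i, j) = ε i + ε j := by
  simp [root, unit_val, Fin.val_inj, h]

theorem root_self {n : ℕ} (κ : ℤ) (i : Fin n) : root n κ (true, i, i) = κ • ε i := by
  simp [root, unit_val]

theorem mem_posRoots_iff {n : ℕ} {κ : ℤ} {v : V n} : v ∈ posRoots n κ ↔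
    (∃ i j : Fin n, i < j ∧ (v = ε i - ε j ∨ v = ε i + ε j)) ∨ ∃ i : Fin n, v = κ • ε i := by
  constructor
  · rintro ⟨⟨b, i, j⟩, ⟨h1, h2⟩, rfl⟩
    simp only at h1 h2
    lift i to Fin n using by omega
    lift j to Fin n using h1
    cases b
    · simp only [Bool.false_eq_true, false_and, or_false] at h2
      exact Or.inl ⟨i, j, h2, Or.inl (root_false κ i j)⟩
    · rcases h2 with h2 | ⟨-, h2⟩
      · exact Or.inl ⟨i, j, h2, Or.inr (root_true κ (Fin.ne_of_lt h2))⟩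
      · obtain rfl := Fin.ext h2
        exact Or.inr ⟨i, root_self κ i⟩
  · rintro (⟨i, j, hij, rfl | rfl⟩ | ⟨i, rfl⟩)
    · exact ⟨(false, i, j), ⟨j.2, Or.inl hij⟩, root_false κ i j⟩
    · exact ⟨(true, i, j), ⟨j.2, Or.inl hij⟩, root_true κ hij.ne⟩
    · exact ⟨(true, i, i), ⟨i.2, Or.inr ⟨rfl, rfl⟩⟩, root_self κ i⟩

theorem posRootsB_eq (n : ℕ) : posRootsB n = posRoots n 1 := by
  ext v
  simp only [mem_posRoots_iff, posRootsB, Set.mem_ofPred_eq, one_smul]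

theorem posRootsC_eq (n : ℕ) : posRootsC n = posRoots n 2 := by
  ext v
  simp only [mem_posRoots_iff, posRootsC, Set.mem_ofPred_eq, two_smul]
  constructor
  · rintro (⟨i, j, hij, rfl⟩ | ⟨i, j, hij, rfl⟩)
    · exact Or.inl ⟨i, j, hij, Or.inl rfl⟩
    · rcases hij.eq_or_lt with rfl | hij
      · exact Or.inr ⟨i, rfl⟩
      · exact Or.inl ⟨i, j, hij, Or.inr rfl⟩
  · rintro (⟨i, j, hij, rfl | rfl⟩ | ⟨i, rfl⟩)
    · exact Or.inl ⟨i, j, hij, rfl⟩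
    · exact Or.inr ⟨i, j, hij.le, rfl⟩
    · exact Or.inr ⟨i, i, le_rfl, rfl⟩

theorem mem_simple_iff {n : ℕ} {κ : ℤ} {v : V n} :
    v ∈ (fun l => root n κ (simpleIndex n l)) '' Set.Iio n ↔
    (∃ i j : Fin n, (i : ℕ) + 1 = j ∧ v = ε i - ε j) ∨
      ∃ i : Fin n, (i : ℕ) + 1 = n ∧ v = κ • ε i := by
  constructor
  · rintro ⟨l, hl, rfl⟩
    simp only [simpleIndex]
    split_ifs with h
    · exact Or.inr ⟨⟨l, hl⟩, h, root_self κ ⟨l, hl⟩⟩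
    · rw [Set.mem_Iio] at hl
      exact Or.inl ⟨⟨l, hl⟩, ⟨l + 1, by omega⟩, rfl, root_false κ ⟨l, hl⟩ ⟨l + 1, by omega⟩⟩
  · rintro (⟨i, j, hij, rfl⟩ | ⟨i, hi, rfl⟩)
    · refine ⟨i, i.2, ?_⟩
      simp only [simpleIndex]
      rw [if_neg (by omega), hij]
      exact root_false κ i j
    · refine ⟨i, i.2, ?_⟩
      simp only [simpleIndex]
      rw [if_pos hi]
      exact root_self κ i

theorem simpleRootsB_eq (n : ℕ) :
    simpleRootsB n = (fun l => root n 1 (simpleIndex n l)) '' Set.Iio n := by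
  ext v
  simp only [mem_simple_iff, simpleRootsB, Set.mem_ofPred_eq, one_smul]

theorem simpleRootsC_eq (n : ℕ) :
    simpleRootsC n = (fun l => root n 2 (simpleIndex n l)) '' Set.Iio n := by
  ext v
  simp only [mem_simple_iff, simpleRootsC, Set.mem_ofPred_eq, two_smul]

theorem level_pos {n : ℕ} {κ : ℤ} (hκ : 0 < κ) {v : V n} (hv : v ∈ posRoots n κ) :
    0 < level n v := by
  rw [mem_posRoots_iff] at hv
  obtain ⟨i, j, hij, rfl | rfl⟩ | ⟨i, rfl⟩ := hv
  · rw [map_sub, level_ε, level_ε]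
    omega
  · rw [map_add, level_ε, level_ε]
    omega
  · rw [map_smul, level_ε, smul_eq_mul]
    exact mul_pos hκ (by omega)

theorem mem_posRoots_of_level_pos {n : ℕ} (κ : ℤ) {s t : ℤ} (hs : s = 1 ∨ s = -1)
    (ht : t = 1 ∨ t = -1) {a b : Fin n} (hab : a ≠ b)
    (h : 0 < level n (s • ε a + t • ε b)) : s • ε a + t • ε b ∈ posRoots n κ := by
  rw [mem_posRoots_iff]
  simp only [map_add, map_smul, level_ε, smul_eq_mul] at h
  left
  rcases lt_or_gt_of_ne hab with hlt | hlt <;> rcases hs with rfl | rfl <;>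
    rcases ht with rfl | rfl <;> first | (exfalso; omega) | skip
  · exact ⟨a, b, hlt, Or.inr (by simp)⟩
  · exact ⟨a, b, hlt, Or.inl (by simp [sub_eq_add_neg])⟩
  · exact ⟨b, a, hlt, Or.inr (by simp [add_comm])⟩
  · exact ⟨b, a, hlt, Or.inl (by simp [sub_eq_add_neg, add_comm])⟩

theorem smul_mem_posRoots_of_level_pos {n : ℕ} {κ s : ℤ} (hκ : 0 < κ) (hs : s = 1 ∨ s = -1)
    {a : Fin n} (h : 0 < level n (κ • s • ε a)) : κ • s • ε a ∈ posRoots n κ := by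
  rw [mem_posRoots_iff]
  simp only [map_smul, level_ε, smul_eq_mul] at h
  have h' := pos_of_mul_pos_right h hκ.le
  right
  rcases hs with rfl | rfl
  · exact ⟨a, by simp⟩
  · exfalso; omega

theorem weylGroup_apply_ε {n : ℕ} (σ : weylGroup n) (i : Fin n) :
    ∃ (s : ℤ) (a : Fin n), (s = 1 ∨ s = -1) ∧ σ.1 (ε i) = s • ε a := by
  have h : σ.1 • ε i ∈ σ.1 • signedBasis n := Set.smul_mem_smul_set ⟨i, Or.inl rfl⟩
  rw [MulAction.mem_stabilizer_iff.1 σ.2] at h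
  obtain ⟨a, h | h⟩ := h
  · exact ⟨1, a, Or.inl rfl, by rw [one_smul]; exact h⟩
  · exact ⟨-1, a, Or.inr rfl, by rw [neg_one_smul]; exact h⟩

theorem exists_weylGroup {n : ℕ} (π : Equiv.Perm (Fin n)) (s : Fin n → ℤ)
    (hs : ∀ i, s i = 1 ∨ s i = -1) :
    ∃ σ : weylGroup n, ∀ i, σ.1 (ε i) = s i • ε (π i) := by
  have hss : ∀ i x, s i * (s i * x) = x := by
    intro i x
    rcases hs i with h | h <;> rw [h] <;> ring
  let e : V n ≃ₗ[ℤ] V n :=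
    { toFun := fun v t => s (π.symm t) * v (π.symm t)
      invFun := fun v i => s i * v (π i)
      map_add' := fun v w => by
        funext t
        simp only [Pi.add_apply, mul_add]
      map_smul' := fun c v => by
        funext t
        simp only [Pi.smul_apply, smul_eq_mul, RingHom.id_apply]
        ring
      left_inv := fun v => by
        funext t
        simp [hss]
      right_inv := fun v => by
        funext t
        simp [hss] }
  have he : ∀ i, e (ε i) = s i • ε (π i) := by
    intro i
    funext t
    change s (π.symm t) * (ε i : V n) (π.symm t) = s i * (ε (π i) : V n) t
    simp only [ε, Pi.single_apply, Equiv.symm_apply_eq]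
    split_ifs with h
    · rw [h, Equiv.symm_apply_apply]
    · simp
  refine ⟨⟨e, ?_⟩, he⟩
  rw [weylGroup, MulAction.mem_stabilizer_iff]
  have key : ∀ i, e (s i • ε i) = ε (π i) := by
    intro i
    rw [map_smul, he, smul_smul]
    have := hss i 1
    rw [mul_one] at this
    rw [this, one_smul]
  ext v
  constructor
  · rintro ⟨_, ⟨i, rfl | rfl⟩, rfl⟩
    · refine ⟨π i, ?_⟩
      change e (ε i) = _ ∨ e (ε i) = _
      rw [he]
      rcases hs i with h | h <;> simp [h]
    · refine ⟨π i, ?_⟩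
      change e (-ε i) = _ ∨ e (-ε i) = _
      rw [map_neg, he]
      rcases hs i with h | h <;> simp [h]
  · rintro ⟨t, h⟩
    obtain ⟨i, rfl⟩ := π.surjective t
    rcases h with rfl | rfl
    · refine ⟨s i • ε i, ⟨i, ?_⟩, key i⟩
      rcases hs i with h | h <;> simp [h]
    · refine ⟨-(s i • ε i), ⟨i, ?_⟩, ?_⟩
      · rcases hs i with h | h <;> simp [h]
      · change e _ = _
        rw [map_neg, key]

/-- The condition for a root to be mapped to a negative root, in terms of the levels `h i` of the
images of the `ε i`. -/
def IsNegative (h : ℕ → ℤ) (q : Bool × ℕ × ℕ) : Prop :=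
  if q.1 then h q.2.1 + h q.2.2 < 0 else h q.2.1 < h q.2.2

/-- A signed permutation maps roots to roots up to sign, and `level` reads off the sign. The
positive factor `κ` does not affect it, which is why types B and C agree. -/
theorem neg_apply_root_mem_iff {n : ℕ} {κ : ℤ} (hκ : 0 < κ) (σ : weylGroup n)
    {q : Bool × ℕ × ℕ} (hq : q ∈ rootIndices n) :
    -(σ.1 (root n κ q)) ∈ posRoots n κ ↔ IsNegative (fun i => level n (σ.1 (unit n i))) q := by
  have hlev : level n (σ.1 (root n κ q)) < 0 ↔
      IsNegative (fun i => level n (σ.1 (unit n i))) q := by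
    obtain ⟨b, i, j⟩ := q
    cases b
    · simp [root, IsNegative]
    · simp only [root, IsNegative, if_true]
      split_ifs with h
      · subst h
        rw [map_smul, map_smul, smul_eq_mul]
        constructor
        · intro h
          have := neg_of_mul_neg_right h hκ.le
          omega
        · intro h
          exact mul_neg_of_pos_of_neg hκ (by omega)
      · simp
  rw [← hlev]
  constructor
  · intro h
    have := level_pos hκ h
    rw [map_neg] at this
    omega
  · intro h
    replace h : 0 < level n (-(σ.1 (root n κ q))) := by
      rw [map_neg]
      omega
    have hmem : root n κ q ∈ posRoots n κ := ⟨q, hq, rfl⟩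
    revert h
    rw [mem_posRoots_iff] at hmem
    -- Two basis vectors sent to the same axis would be equal up to sign.
    have hne : ∀ {i j a b : Fin n} {s t : ℤ}, i < j → (s = 1 ∨ s = -1) → (t = 1 ∨ t = -1) →
        σ.1 (ε i) = s • ε a → σ.1 (ε j) = t • ε b → a ≠ b := by
      rintro i j a b s t hij hs ht h1 h2 rfl
      have h3 : σ.1 (ε i) = σ.1 ((s * t) • ε j) := by
        rw [map_smul, h1, h2, smul_smul]
        rcases hs with rfl | rfl <;> rcases ht with rfl | rfl <;> simp
      have h4 := congrFun (σ.1.injective h3) i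
      simp [ε, hij.ne] at h4
    obtain ⟨i, j, hij, h | h⟩ | ⟨i, h⟩ := hmem <;> rw [h]
    · obtain ⟨s, a, hs, hσi⟩ := weylGroup_apply_ε σ i
      obtain ⟨t, b, ht, hσj⟩ := weylGroup_apply_ε σ j
      rw [map_sub, hσi, hσj,
        show -(s • ε a - t • ε b : V n) = (-s) • ε a + t • ε b by rw [neg_smul]; abel]
      exact mem_posRoots_of_level_pos κ (by omega) ht (hne hij hs ht hσi hσj)
    · obtain ⟨s, a, hs, hσi⟩ := weylGroup_apply_ε σ i
      obtain ⟨t, b, ht, hσj⟩ := weylGroup_apply_ε σ j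
      rw [map_add, hσi, hσj,
        show -(s • ε a + t • ε b : V n) = (-s) • ε a + (-t) • ε b by
          rw [neg_smul, neg_smul]; abel]
      exact mem_posRoots_of_level_pos κ (by omega) (by omega) (hne hij hs ht hσi hσj)
    · obtain ⟨s, a, hs, hσi⟩ := weylGroup_apply_ε σ i
      rw [map_smul, hσi, ← smul_neg, ← neg_smul]
      exact smul_mem_posRoots_of_level_pos hκ (by omega)

theorem inv_posRoots {n : ℕ} {κ : ℤ} (hκ : 0 < κ) (σ : weylGroup n) :
    inv (posRoots n κ) σ = root n κ ''
      {q | q ∈ rootIndices n ∧ IsNegative (fun i => level n (σ.1 (unit n i))) q} := by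
  ext v
  constructor
  · rintro ⟨⟨q, hq, rfl⟩, h⟩
    exact ⟨q, ⟨hq, (neg_apply_root_mem_iff hκ σ hq).1 h⟩, rfl⟩
  · rintro ⟨q, ⟨hq, h⟩, rfl⟩
    exact ⟨⟨q, hq, rfl⟩, (neg_apply_root_mem_iff hκ σ hq).2 h⟩

/-! ### Decompositions in types B and C -/

/-- The colour of the root with a given index. -/
def rootColor (c : (ℕ → ℕ → ℕ) × (ℕ → ℕ → ℕ)) (q : Bool × ℕ × ℕ) : ℕ :=
  if q.1 then c.2 q.2.1 q.2.2 else c.1 q.2.1 q.2.2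

/-- The colouring of the pairs in `[0, 2n)` that unfolds a signed colouring. -/
def unfoldColoring (n : ℕ) (c : (ℕ → ℕ → ℕ) × (ℕ → ℕ → ℕ)) (x y : ℕ) : ℕ :=
  if y < n then c.1 x y else
    if x < n then c.2 x (2 * n - 1 - y) else c.1 (2 * n - 1 - y) (2 * n - 1 - x)

/-- The position `2 * n - 1 - i` stands for `-ε i`. According to how many of `x, y, z` lie in the
upper half, the claim is the triple condition of `d` or that of `p`, reflected if necessary. -/
theorem unfoldColoring_triple {n : ℕ} {c : (ℕ → ℕ → ℕ) × (ℕ → ℕ → ℕ)}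
    (hc : c ∈ signedColorings n 0) {x y z : ℕ} (hxy : x < y) (hyz : y < z) (hz : z < 2 * n) :
    unfoldColoring n c x z = unfoldColoring n c x y ∨
      unfoldColoring n c x z = unfoldColoring n c y z := by
  obtain ⟨⟨-, -, hd⟩, hs, -, -, hp⟩ := hc
  simp only [unfoldColoring]
  have z0 := Nat.zero_le
  rcases lt_or_ge z n with h1 | h1
  · rw [if_pos h1, if_pos (by omega), if_pos (by omega)]
    exact hd x y z (z0 _) hxy hyz h1
  rw [if_neg (not_lt.2 h1), if_neg (not_lt.2 h1)]
  rcases lt_or_ge y n with h2 | h2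
  · rw [if_pos (by omega), if_pos h2, if_pos h2]
    exact hp x y _ (z0 _) hxy h2 (z0 _) (by omega)
  rw [if_neg (not_lt.2 h2), if_neg (not_lt.2 h2)]
  rcases lt_or_ge x n with h3 | h3
  · rw [if_pos h3, if_pos h3, hs x, hs x]
    exact (hp _ (2 * n - 1 - y) x (z0 _) (by omega) (by omega) (z0 _) h3).symm
  · rw [if_neg (not_lt.2 h3), if_neg (not_lt.2 h3)]
    exact (hd _ (2 * n - 1 - y) _ (z0 _) (by omega) (by omega) (by omega)).symm

theorem unfoldColoring_symm {n : ℕ} {c : (ℕ → ℕ → ℕ) × (ℕ → ℕ → ℕ)}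
    (hc : c ∈ signedColorings n 0) {x y : ℕ} (hxy : x < y) (hy : y < 2 * n) :
    unfoldColoring n c (2 * n - 1 - y) (2 * n - 1 - x) = unfoldColoring n c x y := by
  simp only [unfoldColoring]
  rw [show 2 * n - 1 - (2 * n - 1 - y) = y by omega,
    show 2 * n - 1 - (2 * n - 1 - x) = x by omega, hc.2.1 _ x]
  split_ifs <;> first | rfl | omega

/-- The colour classes of a signed colouring are inversion sets. -/
theorem exists_inv_eq {n : ℕ} {κ : ℤ} (hκ : 0 < κ) {c : (ℕ → ℕ → ℕ) × (ℕ → ℕ → ℕ)}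
    (hc : c ∈ signedColorings n 0) (l : ℕ) :
    root n κ '' {q | q ∈ rootIndices n ∧ rootColor c q = l} ∈
      Set.range (inv (posRoots n κ)) := by
  obtain ⟨g, hg1, hg2, hg3, hg4⟩ := exists_rank (N := 2 * n) (c := unfoldColoring n c)
    (fun x y z hxy hyz hz => unfoldColoring_triple hc hxy hyz hz) l
  replace hg4 := hg4 fun x y hxy hy => unfoldColoring_symm hc hxy hy
  -- Folding `[0, 2n)` in half: `g i` splits into the axis `f i` and a sign. The levels computed
  -- below decrease with `g` and change sign under reversal, so comparing values of `g` amounts to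
  -- `IsNegative`.
  let f : Fin n → Fin n := fun i => ⟨if g i < n then g i else 2 * n - 1 - g i, by
    have := hg1 i (by omega)
    split_ifs <;> omega⟩
  have hf : Function.Injective f := by
    intro i j h
    have h := congrArg Fin.val h
    simp only [f] at h
    have := hg1 i (by omega)
    have := hg1 j (by omega)
    have := hg3 i (by omega) j (by omega)
    have := hg3 i (by omega) (2 * n - 1 - j) (by omega)
    have := hg4 j (by omega)
    refine Fin.ext ?_
    split_ifs at h <;> omega
  obtain ⟨σ, hσ⟩ := exists_weylGroup (Equiv.ofBijective f (Finite.injective_iff_bijective.1 hf))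
    (fun i => if g i < n then 1 else -1) (fun i => by split_ifs <;> simp)
  have hlev : ∀ i < n, level n (σ.1 (unit n i)) =
      if g i < n then (n : ℤ) - g i else n - 1 - g i := by
    intro i hi
    have h1 := hg1 i (by omega)
    rw [unit_val ⟨i, hi⟩, hσ, map_smul, level_ε, smul_eq_mul, Equiv.ofBijective_apply]
    simp only [f]
    split_ifs
    · ring
    · push_cast [show g i ≤ 2 * n - 1 by omega, show 1 ≤ 2 * n by omega]
      ring
  refine ⟨σ, ?_⟩
  rw [inv_posRoots hκ]
  congr 1
  ext ⟨b, i, j⟩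
  simp only [Set.mem_ofPred_eq, and_congr_right_iff]
  rintro ⟨hj, h⟩
  simp only at hj h
  have hi : i < n := by omega
  have hgi := hg1 i (by omega)
  have hgj := hg1 j (by omega)
  simp only [IsNegative, rootColor, hlev i hi, hlev j hj]
  cases b
  · simp only [Bool.false_eq_true, false_and, or_false, if_false] at h ⊢
    have := hg2 i j h (by omega)
    simp only [unfoldColoring, if_pos hj] at this
    rw [← this]
    split_ifs <;> omega
  · simp only [if_true]
    have := hg2 i (2 * n - 1 - j) (by omega) (by omega)
    simp only [unfoldColoring] at this
    rw [if_neg (by omega), if_pos hi, show 2 * n - 1 - (2 * n - 1 - j) = j by omega] at this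
    rw [← this, hg4 j (by omega)]
    split_ifs <;> omega

/-- If the colour classes are inversion sets, the class of a root consists of the roots that some
element of the Weyl group makes negative. -/
theorem exists_isNegative_iff {n : ℕ} {κ : ℤ} (hκ : 0 < κ) {f : Bool × ℕ × ℕ → ℕ} {l : ℕ}
    (hinv : root n κ '' {q | q ∈ rootIndices n ∧ f q = l} ∈ Set.range (inv (posRoots n κ))) :
    ∃ h : ℕ → ℤ, ∀ q ∈ rootIndices n, f q = l ↔ IsNegative h q := by
  obtain ⟨σ, hσ⟩ := hinv
  rw [inv_posRoots hκ] at hσ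
  have := (root_injOn n hκ).image_eq_image_iff (fun q hq => hq.1) (fun q hq => hq.1) |>.1 hσ
  refine ⟨fun i => level n (σ.1 (unit n i)), fun q hq => ?_⟩
  have h := Set.ext_iff.1 this q
  simp only [Set.mem_ofPred_eq, hq, true_and] at h
  exact h.symm

theorem catBC_eq_signedCatalan (n : ℕ) {κ : ℤ} (hκ : 0 < κ) :
    catBC n (posRoots n κ) ((fun l => root n κ (simpleIndex n l)) '' Set.Iio n) =
      signedCatalan n := by
  have h1 := (finite_signedColorings_and_ncard n 0).2
  rw [Nat.sub_zero] at h1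
  rw [← h1, catBC, ncard_decompositions (P := posRoots n κ) (L := Set.Iio n)
    (X := signedColorings n 0) (F := rootColor) (root_injOn n hκ) rfl (fun l hl => simpleIndex_mem hl) (simpleIndex_injective n).injOn]
  · intro c hc
    refine ⟨fun ⟨b, i, j⟩ hq => ?_, fun l hl => ?_, fun l _ => exists_inv_eq hκ hc l⟩
    · obtain ⟨hj, h⟩ := hq
      simp only at hj h
      cases b
      · simp only [Bool.false_eq_true, false_and, or_false] at h
        exact (pairColorings_bounds hc.1 (Nat.zero_le _) h hj).2.trans hj
      · exact (signedColorings_bounds hc (Nat.zero_le _) (show i < n by omega) (Nat.zero_le _) hj).2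
    · rw [Set.mem_Iio] at hl
      simp only [rootColor, simpleIndex]
      split_ifs with h h' <;> simp only [not_true] at *
      · have := hc.2.2.2.1 (by omega)
        rwa [show n - 1 = l by omega] at this
      · exact hc.1.2.1 l (Nat.zero_le _) (by omega)
  · rintro ⟨d, p⟩ h ⟨d', p'⟩ h' he
    have hp : ∀ i j, i ≤ j → j < n → p i j = p' i j := fun i j hij hj =>
      he (true, i, j) ⟨hj, hij.lt_or_eq.imp_right fun h => ⟨rfl, h⟩⟩
    refine Prod.ext ?_ ?_ <;> funext i j
    · by_cases hij : i < j ∧ j < n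
      · exact he (false, i, j) ⟨hij.2, Or.inl hij.1⟩
      · exact (h.1.1 i j (by omega)).trans (h'.1.1 i j (by omega)).symm
    · by_cases hij : i < n ∧ j < n
      · rcases le_total i j with hle | hle
        · exact hp i j hle hij.2
        · exact (h.2.1 i j).trans ((hp j i hle hij.1).trans (h'.2.1 j i))
      · exact (h.2.2.1 i j (by omega)).trans (h'.2.2.1 i j (by omega)).symm
  · intro f hf1 hf2 hf3
    -- Both triple conditions are now arithmetic on levels: `h i < h k` forces `h i < h j` or `h j <
    -- h k`, and `h i + h k < 0` forces `h i < h j` or `h j + h k < 0`.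
    have hf4 := fun q hq => exists_isNegative_iff hκ (hf3 (f q) (hf1 q hq))
    have hmem : ∀ i j, i < n → j < n → (true, min i j, max i j) ∈ rootIndices n := by
      intro i j hi hj
      refine ⟨by simp only; omega, ?_⟩
      simp only [true_and]
      omega
    have hneg : ∀ (h : ℕ → ℤ) i j, IsNegative h (true, min i j, max i j) ↔ h i + h j < 0 := by
      intro h i j
      simp only [IsNegative, if_true]
      rcases le_total i j with hle | hle
      · simp [hle]
      · simp [hle, add_comm]
    refine ⟨(fun i j => if i < j ∧ j < n then f (false, i, j) else 0,
      fun i j => if i < n ∧ j < n then f (true, min i j, max i j) else 0),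
      ⟨⟨fun i j h => if_neg (by omega), fun i _ hi => ?_, fun i j k _ hij hjk hk => ?_⟩,
        fun i j => ?_, fun i j h => if_neg (by omega), fun hn => ?_,
        fun i j k _ hij hj _ hk => ?_⟩, fun ⟨b, i, j⟩ hq => ?_⟩
    · simp only
      rw [if_pos ⟨by omega, hi⟩]
      have := hf2 i (by simp only [Set.mem_Iio]; omega)
      rwa [simpleIndex, if_neg (by omega)] at this
    · simp only
      rw [if_pos (by omega), if_pos (by omega), if_pos (by omega)]
      obtain ⟨h, hh⟩ := hf4 (false, i, k) ⟨hk, Or.inl (hij.trans hjk)⟩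
      have h1 := (hh (false, i, k) ⟨hk, Or.inl (hij.trans hjk)⟩).1 rfl
      have h2 := hh (false, i, j) ⟨hjk.trans hk, Or.inl hij⟩
      have h3 := hh (false, j, k) ⟨hk, Or.inl hjk⟩
      simp only [IsNegative, Bool.false_eq_true, if_false] at h1 h2 h3
      rw [eq_comm, h2, eq_comm, h3]
      omega
    · simp only [min_comm i, max_comm i, and_comm (a := i < n)]
    · simp only [min_self, max_self]
      rw [if_pos (by omega)]
      have := hf2 (n - 1) (by simp only [Set.mem_Iio]; omega)
      rwa [simpleIndex, if_pos (by omega)] at this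
    · simp only
      rw [if_pos (by omega), if_pos (by omega), if_pos (by omega)]
      have hi : i < n := by omega
      obtain ⟨h, hh⟩ := hf4 _ (hmem i k hi hk)
      have h1 := (hh _ (hmem i k hi hk)).1 rfl
      have h2 := hh (false, i, j) ⟨hj, Or.inl hij⟩
      have h3 := hh _ (hmem j k hj hk)
      rw [hneg] at h1 h3
      simp only [IsNegative, Bool.false_eq_true, if_false] at h2
      rw [eq_comm, h2, eq_comm, h3]
      omega
    · obtain ⟨hj, h⟩ := hq
      simp only at hj h
      cases b
      · simp only [Bool.false_eq_true, false_and, or_false] at h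
        simp [rootColor, h, hj]
      · have hle : i ≤ j := by omega
        simp [rootColor, hj, hle, show i < n by omega]

theorem catB_eq_signedCatalan (n : ℕ) : catB n = signedCatalan n := by
  rw [catB, posRootsB_eq, simpleRootsB_eq]
  exact catBC_eq_signedCatalan n one_pos

theorem catC_eq_signedCatalan (n : ℕ) : catC n = signedCatalan n := by
  rw [catC, posRootsC_eq, simpleRootsC_eq]
  exact catBC_eq_signedCatalan n two_pos

/-! ### Recurrence and generating function -/

theorem signedCatalan_succ_eq_add (n : ℕ) : signedCatalan (n + 1) =
    signedCatalan n + 2 * ∑ k ∈ Finset.range n, catalan (n - k) * signedCatalan k := by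
  have e : ∑ k ∈ Finset.range n, catalan (n - k) * signedCatalan k =
      ∑ s ∈ Finset.range n, catalan (s + 1) * signedCatalan (n - (s + 1)) := by
    rw [← Finset.sum_range_reflect]
    refine Finset.sum_congr rfl fun k hk => ?_
    rw [Finset.mem_range] at hk
    congr 2
    · omega
    · omega
  -- The term `s = 0` occurs in the first sum only and contributes `signedCatalan n`; all other
  -- terms occur twice.
  rw [signedCatalan_succ, e, Finset.sum_range_succ', Finset.sum_range_succ' (n := n)]
  simp
  ring

open PowerSeries in
/-- The square root of `1 - 4z` in terms of the Catalan series. -/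
theorem sqrtOneSubFour_eq :
    sqrtOneSubFour = 1 - 2 * X * (catalanSeries.map (Nat.castRingHom ℚ)) := by
  have hC : (catalanSeries.map (Nat.castRingHom ℚ)) ^ 2 * X + 1 =
      catalanSeries.map (Nat.castRingHom ℚ) := by
    have := congrArg (PowerSeries.map (Nat.castRingHom ℚ)) catalanSeries_sq_mul_X_add_one
    simpa using this
  have hsq : sqrtOneSubFour * sqrtOneSubFour = 1 - 4 * X := by
    rw [sqrtOneSubFour, ← map_mul, ← binomialSeries_add,
      show (1 / 2 + 1 / 2 : ℚ) = ((1 : ℕ) : ℚ) by norm_num, binomialSeries_nat]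
    have h4 : (C (4 : ℚ) : PowerSeries ℚ) = 4 := map_ofNat C 4
    simp [rescale_X, h4]
    ring
  -- Both series square to `1 - 4z`, so in a domain they agree up to sign; the constant term `1`
  -- excludes the minus sign.
  have hprod : (sqrtOneSubFour - (1 - 2 * X * (catalanSeries.map (Nat.castRingHom ℚ)))) *
      (sqrtOneSubFour + (1 - 2 * X * (catalanSeries.map (Nat.castRingHom ℚ)))) = 0 := by
    linear_combination hsq - 4 * X * hC
  rcases mul_eq_zero.1 hprod with h | h
  · exact sub_eq_zero.1 h
  · exfalso
    have := congrArg (constantCoeff (R := ℚ)) h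
    have h1 : constantCoeff sqrtOneSubFour = 1 := by
      rw [sqrtOneSubFour, ← coeff_zero_eq_constantCoeff_apply, coeff_rescale]
      simp
    simp [h1] at this

open PowerSeries in
theorem mk_signedCatalan_mul :
    PowerSeries.mk (fun n : ℕ => (signedCatalan n : ℚ)) * (sqrtOneSubFour + X) = 1 := by
  -- Completing the second sum by its missing term `s = 0` makes both sums full convolutions, at the
  -- cost of subtracting `signedCatalan n`.
  have hrec : ∀ n, (signedCatalan (n + 1) : ℚ) =
      2 * ∑ s ∈ Finset.range (n + 1), (catalan s * signedCatalan (n - s) : ℚ) -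
        signedCatalan n := by
    intro n
    rw [signedCatalan_succ, Finset.sum_range_succ', Finset.sum_range_succ']
    simp only [Nat.succ_ne_zero, if_false, if_true, Finset.sum_range_succ']
    push_cast
    simp
    ring
  rw [sqrtOneSubFour_eq, show ∀ B C : PowerSeries ℚ, B * (1 - 2 * X * C + X) =
    B - X * (C * B + C * B - B) from fun B C => by ring]
  ext n
  cases n with
  | zero => simp [signedCatalan_zero]
  | succ n =>
    rw [map_sub, coeff_succ_X_mul, map_sub, map_add, coeff_mul,
      Finset.Nat.sum_antidiagonal_eq_sum_range_succ_mk]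
    simp only [coeff_mk, coeff_map, catalanSeries, hrec, coeff_one, Nat.succ_ne_zero, if_false,
      eq_natCast]
    ring

end InvSets

theorem mainTheorem6 :
    (∀ m : ℕ, InvSets.catA m = catalan m) ∧
    (∀ n : ℕ, InvSets.catC n = InvSets.catB n) ∧
    (∀ n : ℕ, 1 ≤ n →
      InvSets.catB n = InvSets.catB (n - 1) +
        2 * ∑ k ∈ Finset.range (n - 1), InvSets.catA (n - k - 1) * InvSets.catB k) ∧
    PowerSeries.mk (fun n : ℕ => (InvSets.catB n : ℚ)) =
      (InvSets.sqrtOneSubFour + PowerSeries.X)⁻¹ := by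
  simp only [InvSets.catA_eq_catalan, InvSets.catB_eq_signedCatalan, InvSets.catC_eq_signedCatalan]
  refine ⟨fun _ => trivial, fun _ => trivial, fun n hn => ?_, ?_⟩
  · obtain ⟨n, rfl⟩ : ∃ m, n = m + 1 := ⟨n - 1, by omega⟩
    rw [InvSets.signedCatalan_succ_eq_add, Nat.add_sub_cancel]
    congr 2
    refine Finset.sum_congr rfl fun k _ => ?_
    rw [show n + 1 - k - 1 = n - k by omega]
  · rw [PowerSeries.eq_inv_iff_mul_eq_one]
    · exact InvSets.mk_signedCatalan_mul
    · intro h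
      have := congrArg PowerSeries.constantCoeff InvSets.mk_signedCatalan_mul
      rw [map_mul, h, mul_zero, map_one] at this
      exact zero_ne_one this
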